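/- Let $\mathbb{N}=\{1,2,\dots\}$ and let $\mathbb{N}^*=\mathbb{N}\cup\{\infty\}$ carry the metric $d(i,j)=\sum_{k=i}^{j-1}2^{-k}$, $1\le i<j\le\infty$ (whose topology is that of the one-point compactification of $\mathbb{N}$). Let $S(\mathbb{N},\mathbb{N}^*)$ be the set of functions $\sigma:\mathbb{N}\to\mathbb{N}^*$ such that $\sigma_i=\sigma_j$ with $i\ne j$ implies $\sigma_i=\infty$, with the topology induced by the product topology on $\mathbb{N}^*\times\mathbb{N}^*\times\cdots$. A permutation $\sigma$ of $[n]=\{1,\dots,n\}$ is regarded as an element of $S(\mathbb{N},\mathbb{N}^*)$ by setting $\sigma_j=j$ for $j>n$. A finite word $w_1\cdots w_k$ of distinct positive integers is 231-avoiding if there are no $i_1<i_2<i_3$ with $w_{i_3}<w_{i_1}<w_{i_2}$. Let $\mu_n^{231}$ be the uniform distribution on the set of 231-avoiding permutations of $[n]$, considered as a Borel probability measure on $S(\mathbb{N},\mathbb{N}^*)$. A permutation image of a finite block $I$ of consecutive positive integers (possibly empty) is a word in which each element of $I$ occurs exactly once and nothing else occurs. On a probability space, let the random variables $X_1,X_2,\dots$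 and $\Pi_I$, $I$ ranging over the finite blocks, all be mutually independent, with $$P(X_j=n)=\frac{C_n}{2\cdot 4^n},\qquad n=0,1,2,\dots,\qquad C_n=\frac1{n+1}\binom{2n}{n},$$ for every $j$, and with $\Pi_I$ uniformly distributed over the 231-avoiding permutation images of $I$. Let $T_0=0$ and $T_n=X_1+\cdots+X_n$, and let $*$ denote concatenation of words. Consider the random element of $S(\mathbb{N},\mathbb{N}^*)$ $$Z=\Pi_{[1,T_1]}*(\infty)*\Pi_{[T_1+1,T_2]}*(\infty)*\Pi_{[T_2+1,T_3]}*(\infty)*\cdots,$$ where $[T_{n-1}+1,T_n]$ is the empty block if $X_n=0$. Then, as $n\to\infty$, $\mu_n^{231}$ converges weakly to the distribution of $Z$. Moreover, $Z$ is almost surely a surjection of $\mathbb{N}$ onto $\mathbb{N}^*$, and the i.i.d. block lengths $X_j$ have infinite mean. -/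

import Mathlib

open MeasureTheory ProbabilityTheory Filter Topology
open scoped ENNReal

/-! ### The space `S(ℕ, ℕ*)`

`ℕ = {1, 2, …}` is `ℕ+`, and `ℕ* = ℕ ∪ {∞}` is its one-point compactification. -/

/-- `ℕ* = ℕ ∪ {∞}`. -/
abbrev NStar : Type := OnePoint ℕ+

/-- The map `i ↦ ∑_{k ≥ i} 2^{-k} = 2 * 2^{-i}`, `∞ ↦ 0`. The metric `∑_{k=i}^{j-1} 2^{-k}`
(`i < j ≤ ∞`) on `ℕ*` is `|NStar.tail i - NStar.tail j|`. -/
noncomputable def NStar.tail : NStar → ℝ :=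
  fun x => OnePoint.elim x (0 : ℝ) (fun k : ℕ+ => 2 * (1 / 2 : ℝ) ^ (k : ℕ))

/-- The topology of `ℕ*` is the one given by the metric `|NStar.tail i - NStar.tail j|`. -/
theorem NStar.isEmbedding_tail : IsEmbedding NStar.tail := by
  have hcont : Continuous NStar.tail := by
    rw [OnePoint.continuous_iff_from_discrete]
    have h : Tendsto (fun k : ℕ => 2 * (1 / 2 : ℝ) ^ k) atTop (𝓝 0) := by
      simpa using (tendsto_pow_atTop_nhds_zero_of_lt_one (r := (1 / 2 : ℝ))
        (by norm_num) (by norm_num)).const_mul 2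
    have h2 : Tendsto (fun k : ℕ+ => (k : ℕ)) cofinite atTop := by
      rw [← Nat.cofinite_eq_atTop]
      exact PNat.coe_injective.tendsto_cofinite
    exact h.comp h2
  have hinj : Function.Injective NStar.tail := by
    have hpos : ∀ k : ℕ+, NStar.tail k ≠ 0 := fun k => by
      change 2 * (1 / 2 : ℝ) ^ (k : ℕ) ≠ 0
      positivity
    intro x y hxy
    induction x using OnePoint.rec with
    | infty =>
      induction y using OnePoint.rec with
      | infty => rfl
      | coe j => exact absurd hxy.symm (hpos j)
    | coe i =>
      induction y using OnePoint.rec with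
      | infty => exact absurd hxy (hpos i)
      | coe j =>
        have h1 : 2 * (1 / 2 : ℝ) ^ (i : ℕ) = 2 * (1 / 2 : ℝ) ^ (j : ℕ) := hxy
        have h2 : (1 / 2 : ℝ) ^ (i : ℕ) = (1 / 2 : ℝ) ^ (j : ℕ) := by linarith
        have h3 := pow_right_injective₀ (a := (1 / 2 : ℝ)) (by norm_num) (by norm_num) h2
        rw [PNat.coe_injective h3]
  exact (hcont.isClosedEmbedding hinj).isEmbedding

/-- `S(ℕ, ℕ*)`: the functions `σ : ℕ → ℕ*` such that `σ i = σ j`, `i ≠ j`, forces `σ i = ∞`.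
The topology is the one induced by the product topology of `ℕ* × ℕ* × ⋯`. -/
def SNStar : Type :=
  {σ : ℕ+ → NStar // ∀ i j, i ≠ j → σ i = σ j → σ i = OnePoint.infty}

namespace SNStar

instance : TopologicalSpace SNStar :=
  inferInstanceAs (TopologicalSpace
    {σ : ℕ+ → NStar // ∀ i j, i ≠ j → σ i = σ j → σ i = OnePoint.infty})

instance : MeasurableSpace SNStar := borel SNStar

instance : BorelSpace SNStar := ⟨rfl⟩

instance : CoeFun SNStar (fun _ => ℕ+ → NStar) := ⟨Subtype.val⟩

end SNStar

/-! ### Pattern avoidance -/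

/-- The word `w₁ ⋯ w_n` avoids the pattern `τ₁ ⋯ τ_m`: it has no subsequence whose terms are in
the same relative order as those of `τ`. -/
def Avoids {α : Type*} [LT α] {n m : ℕ} (w : Fin n → α) (τ : Fin m → ℕ) : Prop :=
  ¬ ∃ f : Fin m → Fin n, StrictMono f ∧ ∀ j k, w (f j) < w (f k) ↔ τ j < τ k

/-- The pattern `231`. -/
def pattern231 : Fin 3 → ℕ := ![2, 3, 1]

theorem StrictMono.avoids231 {α : Type*} [Preorder α] {n : ℕ} {w : Fin n → α}
    (hw : StrictMono w) : Avoids w pattern231 := by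
  rintro ⟨f, hf, h⟩
  have h1 : w (f 2) < w (f 0) := (h 2 0).2 (by decide)
  have h2 : w (f 0) < w (f 2) := hw (hf (by decide))
  exact lt_asymm h1 h2

/-- `S_n(τ)`: the permutations of `n` letters that avoid `τ`. -/
def AvoidingPerm {m : ℕ} (τ : Fin m → ℕ) (n : ℕ) : Type :=
  {σ : Equiv.Perm (Fin n) // Avoids σ τ}

noncomputable instance {m : ℕ} (τ : Fin m → ℕ) (n : ℕ) : Fintype (AvoidingPerm τ n) :=
  @Fintype.ofFinite _ (inferInstanceAs (Finite {σ : Equiv.Perm (Fin n) // Avoids σ τ}))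

instance (n : ℕ) : Nonempty (AvoidingPerm pattern231 n) :=
  ⟨⟨1, StrictMono.avoids231 (w := ((1 : Equiv.Perm (Fin n)) : Fin n → Fin n)) strictMono_id⟩⟩

/-- The extension of a permutation of `[n]` to `ℕ` by `σ_j = j` for `j > n`, seen in `S(ℕ, ℕ*)`.
The index `i : Fin n` stands for the number `i + 1 ∈ [n]`. -/
def permToSNStar {n : ℕ} (σ : Equiv.Perm (Fin n)) : SNStar :=
  ⟨fun j => if h : j.natPred < n then (((σ ⟨j.natPred, h⟩ : ℕ).succPNat : ℕ+) : NStar)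
      else (j : NStar), by
    intro i j hij h
    exfalso
    apply hij
    apply PNat.natPred_injective
    by_cases hi : i.natPred < n <;> by_cases hj : j.natPred < n
    · simp only [hi, hj, dif_pos, OnePoint.coe_eq_coe] at h
      have h1 := Nat.succPNat_injective h
      have h2 := σ.injective (Fin.ext h1)
      simpa using h2
    · simp only [hi, hj, dif_pos, dif_neg, not_false_eq_true, OnePoint.coe_eq_coe] at h
      have := (σ ⟨i.natPred, hi⟩).2
      rw [← h, Nat.natPred_succPNat] at hj
      exact absurd this hj
    · simp only [hi, hj, dif_pos, dif_neg, not_false_eq_true, OnePoint.coe_eq_coe] at h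
      have := (σ ⟨j.natPred, hj⟩).2
      rw [h, Nat.natPred_succPNat] at hi
      exact absurd this hi
    · simp only [hi, hj, dif_neg, not_false_eq_true, OnePoint.coe_eq_coe] at h
      rw [h]⟩

/-- `μ_n^{231}`: the uniform distribution on `S_n(231)`, as a probability measure on
`S(ℕ, ℕ*)`. -/
noncomputable def mu231 (n : ℕ) : ProbabilityMeasure SNStar :=
  ⟨((PMF.uniformOfFintype (AvoidingPerm pattern231 n)).map
      (fun σ => permToSNStar σ.1)).toMeasure, inferInstance⟩

/-! ### Permutation images of blocks -/

/-- The block `[s + 1, t]` of consecutive positive integers; it is empty if `t ≤ s`. -/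
def blockIcc (s t : ℕ) : Finset ℕ+ := Finset.Ico s.succPNat t.succPNat

theorem mem_blockIcc {s t : ℕ} {k : ℕ+} : k ∈ blockIcc s t ↔ s + 1 ≤ (k : ℕ) ∧ (k : ℕ) ≤ t := by
  rw [blockIcc, Finset.mem_Ico, ← PNat.coe_le_coe, ← PNat.coe_lt_coe, Nat.succPNat_coe,
    Nat.succPNat_coe, Nat.lt_succ_iff]

/-- The finite blocks of positive integers, the empty one included. -/
def FiniteBlock : Type := {I : Finset ℕ+ // ∃ s t : ℕ, I = blockIcc s t}

/-- The finite block `[s + 1, t]`. -/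
def FiniteBlock.mk' (s t : ℕ) : FiniteBlock := ⟨blockIcc s t, s, t, rfl⟩

/-- The permutation images of `I` (the words in which every element of `I` occurs exactly once,
and nothing else occurs) that avoid `τ`. -/
def AvoidingImage {m : ℕ} (τ : Fin m → ℕ) (I : Finset ℕ+) : Type :=
  {w : List ℕ+ // w.Nodup ∧ w.toFinset = I ∧ Avoids w.get τ}

instance {m : ℕ} (τ : Fin m → ℕ) (I : Finset ℕ+) : Finite (AvoidingImage τ I) := by
  have h : Set.Finite {w : List ℕ+ | w.Nodup ∧ w.toFinset = I ∧ Avoids w.get τ} := by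
    refine (List.finite_toSet I.toList.permutations).subset ?_
    rintro w ⟨hw, rfl, -⟩
    simp only [Set.mem_ofPred_eq, List.mem_permutations]
    exact (List.perm_ext_iff_of_nodup hw (Finset.nodup_toList _)).2 (by simp)
  exact h.to_subtype

noncomputable instance {m : ℕ} (τ : Fin m → ℕ) (I : Finset ℕ+) : Fintype (AvoidingImage τ I) :=
  Fintype.ofFinite _

instance (I : Finset ℕ+) : Nonempty (AvoidingImage pattern231 I) :=
  ⟨⟨I.sort (· ≤ ·), I.sort_nodup _, I.sort_toFinset _,
    StrictMono.avoids231 (I.sortedLT_sort.strictMono_get)⟩⟩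

/-- The discrete σ-algebra. -/
instance {m : ℕ} (τ : Fin m → ℕ) (I : Finset ℕ+) : MeasurableSpace (AvoidingImage τ I) := ⊤

/-! ### Infinite concatenation -/

/-- The finite word `v 0 * v 1 * ⋯ * v (N - 1)`. -/
def concatPrefix {α : Type*} (v : ℕ → List α) (N : ℕ) : List α := (List.range N).flatMap v

theorem concatPrefix_succ {α : Type*} (v : ℕ → List α) (N : ℕ) :
    concatPrefix v (N + 1) = concatPrefix v N ++ v N := by
  simp [concatPrefix, List.range_succ]

theorem le_length_concatPrefix {α : Type*} {v : ℕ → List α} (hv : ∀ n, v n ≠ []) (N : ℕ) :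
    N ≤ (concatPrefix v N).length := by
  induction N with
  | zero => exact Nat.zero_le _
  | succ N ih =>
    rw [concatPrefix_succ, List.length_append]
    have := List.length_pos_iff.2 (hv N)
    omega

theorem concatPrefix_isPrefix {α : Type*} (v : ℕ → List α) {M N : ℕ} (h : M ≤ N) :
    concatPrefix v M <+: concatPrefix v N := by
  induction N, h using Nat.le_induction with
  | base => exact List.prefix_rfl
  | succ N _ ih =>
    rw [concatPrefix_succ]
    exact ih.trans (List.prefix_append _ _)

/-- The infinite word `v 0 * v 1 * v 2 * ⋯`, for non-empty words `v n`: its `j`-th letter is that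
of `v 0 * ⋯ * v (N - 1)` for any `N` large enough, for instance `N = j`. -/
def infiniteConcat {α : Type*} (v : ℕ → List α) (hv : ∀ n, v n ≠ []) (j : ℕ+) : α :=
  (concatPrefix v j)[j.natPred]'(by
    have := le_length_concatPrefix hv j
    have := PNat.natPred_add_one j
    omega)

/-! ### The regenerative function -/

/-- `T_n = x_1 + ⋯ + x_n`, where `x_j` is `x (j - 1)`. -/
def partialSum (x : ℕ → ℕ) (n : ℕ) : ℕ := ∑ j ∈ Finset.range n, x j

/-- The word `π_{[T_n + 1, T_{n+1}]} * ∞^{(1)}`. -/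
def regenWord (x : ℕ → ℕ) (π : ∀ I : FiniteBlock, AvoidingImage pattern231 I.1) (n : ℕ) :
    List NStar :=
  (π (FiniteBlock.mk' (partialSum x n) (partialSum x (n + 1)))).1.map (fun k : ℕ+ => (k : NStar))
    ++ [OnePoint.infty]

theorem regenWord_ne_nil (x : ℕ → ℕ) (π : ∀ I : FiniteBlock, AvoidingImage pattern231 I.1)
    (n : ℕ) : regenWord x π n ≠ [] := by
  simp [regenWord]

theorem coe_mem_regenWord {x : ℕ → ℕ} {π : ∀ I : FiniteBlock, AvoidingImage pattern231 I.1}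
    {n : ℕ} {k : ℕ+} (h : (k : NStar) ∈ regenWord x π n) :
    partialSum x n + 1 ≤ (k : ℕ) ∧ (k : ℕ) ≤ partialSum x (n + 1) := by
  simp only [regenWord, List.mem_append, List.mem_map, List.mem_singleton,
    OnePoint.coe_ne_infty, or_false, OnePoint.coe_eq_coe, exists_eq_right] at h
  rw [← List.mem_toFinset,
    (π (FiniteBlock.mk' (partialSum x n) (partialSum x (n + 1)))).2.2.1] at h
  exact mem_blockIcc.1 h

theorem pairwise_regenWord (x : ℕ → ℕ) (π : ∀ I : FiniteBlock, AvoidingImage pattern231 I.1)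
    (n : ℕ) : (regenWord x π n).Pairwise (fun a b => a = b → a = OnePoint.infty) := by
  rw [regenWord, List.pairwise_append]
  refine ⟨?_, List.pairwise_singleton _ _, ?_⟩
  · rw [List.pairwise_map]
    refine (π (FiniteBlock.mk' (partialSum x n) (partialSum x (n + 1)))).2.1.imp ?_
    intro a b hab h
    exact absurd (OnePoint.coe_injective h) hab
  · intro a _ b hb h
    rw [h]
    simpa using hb

theorem pairwise_concatPrefix (x : ℕ → ℕ) (π : ∀ I : FiniteBlock, AvoidingImage pattern231 I.1)
    (N : ℕ) : (concatPrefix (regenWord x π) N).Pairwise (fun a b => a = b → a = OnePoint.infty) ∧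
      ∀ k : ℕ+, (k : NStar) ∈ concatPrefix (regenWord x π) N → (k : ℕ) ≤ partialSum x N := by
  induction N with
  | zero => simp [concatPrefix]
  | succ N ih =>
    rw [concatPrefix_succ]
    have hle : partialSum x N ≤ partialSum x (N + 1) := by
      simp [partialSum, Finset.sum_range_succ]
    refine ⟨List.pairwise_append.2 ⟨ih.1, pairwise_regenWord x π N, ?_⟩, ?_⟩
    · intro a ha b hb hab
      subst hab
      induction a using OnePoint.rec with
      | infty => rfl
      | coe k =>
        have h1 := ih.2 k ha
        have h2 := (coe_mem_regenWord hb).1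
        omega
    · intro k hk
      rcases List.mem_append.1 hk with hk | hk
      · exact (ih.2 k hk).trans hle
      · exact (coe_mem_regenWord hk).2

/-- The function `π_{[1, T_1]} * ∞^{(1)} * π_{[T_1 + 1, T_2]} * ∞^{(1)} * ⋯` of `S(ℕ, ℕ*)`, for
block lengths `x_1, x_2, …` and a choice of a `231`-avoiding permutation image `π_I` for every
finite block `I`. -/
def regenFun (x : ℕ → ℕ) (π : ∀ I : FiniteBlock, AvoidingImage pattern231 I.1) : SNStar :=
  ⟨infiniteConcat (regenWord x π) (regenWord_ne_nil x π), by
    have key : ∀ i j : ℕ+, i < j →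
        infiniteConcat (regenWord x π) (regenWord_ne_nil x π) i =
          infiniteConcat (regenWord x π) (regenWord_ne_nil x π) j →
        infiniteConcat (regenWord x π) (regenWord_ne_nil x π) i = OnePoint.infty := by
      intro i j hij h
      have hij' : (i : ℕ) < j := hij
      have hlen := le_length_concatPrefix (regenWord_ne_nil x π) (i : ℕ)
      have hlen' := le_length_concatPrefix (regenWord_ne_nil x π) (j : ℕ)
      have hi := PNat.natPred_add_one i
      have hj := PNat.natPred_add_one j
      have e : infiniteConcat (regenWord x π) (regenWord_ne_nil x π) i =
          (concatPrefix (regenWord x π) j)[i.natPred]'(by omega) :=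
        (concatPrefix_isPrefix (regenWord x π) hij'.le).getElem (by omega)
      rw [e] at h ⊢
      exact List.pairwise_iff_getElem.1 (pairwise_concatPrefix x π j).1 i.natPred j.natPred
        (by omega) (by omega) (by omega) h
    intro i j hij h
    rcases lt_or_gt_of_ne hij with hlt | hlt
    · exact key i j hlt h
    · rw [h]
      exact key j i hlt h.symm⟩

/-! ### The distribution of the block lengths -/

theorem centralBinom_sq_le (n : ℕ) :
    ((n.centralBinom : ℝ) / 4 ^ n) ^ 2 * (2 * n + 1) ≤ 1 := by
  induction n with
  | zero => simp
  | succ n ih =>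
    have h : ((n : ℝ) + 1) * ((n + 1).centralBinom : ℝ) = 2 * (2 * n + 1) * n.centralBinom := by
      exact_mod_cast Nat.succ_mul_centralBinom_succ n
    have h1 : ((n + 1).centralBinom : ℝ) / 4 ^ (n + 1) =
        (n.centralBinom : ℝ) / 4 ^ n * ((2 * n + 1) / (2 * n + 2)) := by
      have h2 : ((n + 1).centralBinom : ℝ) = 2 * (2 * n + 1) * n.centralBinom / (n + 1) := by
        rw [← h]
        field_simp
      rw [h2, pow_succ]
      field_simp
      ring
    rw [h1]
    have h3 : ((2 * (n : ℝ) + 1) / (2 * n + 2)) ^ 2 * (2 * (n + 1 : ℕ) + 1) ≤ 2 * n + 1 := by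
      rw [div_pow, div_mul_eq_mul_div, div_le_iff₀ (by positivity)]
      push_cast
      nlinarith [Nat.cast_nonneg (α := ℝ) n]
    calc _ = ((n.centralBinom : ℝ) / 4 ^ n) ^ 2 *
          (((2 * (n : ℝ) + 1) / (2 * n + 2)) ^ 2 * (2 * (n + 1 : ℕ) + 1)) := by ring
      _ ≤ ((n.centralBinom : ℝ) / 4 ^ n) ^ 2 * (2 * n + 1) := by gcongr
      _ ≤ 1 := ih

theorem tendsto_centralBinom_div :
    Tendsto (fun n : ℕ => (n.centralBinom : ℝ) / 4 ^ n) atTop (𝓝 0) := by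
  have h : Tendsto (fun n : ℕ => Real.sqrt (1 / (2 * (n : ℝ) + 1))) atTop (𝓝 0) := by
    have h1 : Tendsto (fun n : ℕ => 2 * (n : ℝ) + 1) atTop atTop :=
      tendsto_atTop_add_const_right _ _
        (tendsto_natCast_atTop_atTop.const_mul_atTop (by norm_num))
    have h2 : Tendsto (fun n : ℕ => 1 / (2 * (n : ℝ) + 1)) atTop (𝓝 0) := by
      simp only [one_div]
      exact h1.inv_tendsto_atTop
    have h3 := (Real.continuous_sqrt.tendsto 0).comp h2
    rw [Real.sqrt_zero] at h3
    exact h3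
  refine squeeze_zero (fun n => by positivity) (fun n => ?_) h
  apply Real.le_sqrt_of_sq_le
  rw [le_div_iff₀ (by positivity)]
  exact centralBinom_sq_le n

theorem hasSum_catalan : HasSum (fun n : ℕ => (catalan n : ℝ) / (2 * 4 ^ n)) 1 := by
  rw [hasSum_iff_tendsto_nat_of_nonneg (fun n => by positivity)]
  have h : ∀ N : ℕ, ∑ n ∈ Finset.range N, (catalan n : ℝ) / (2 * 4 ^ n) =
      1 - (N.centralBinom : ℝ) / 4 ^ N := by
    intro N
    induction N with
    | zero => simp
    | succ n ih =>
      have h1 : ((n : ℝ) + 1) * ((n + 1).centralBinom : ℝ) = 2 * (2 * n + 1) * n.centralBinom := by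
        exact_mod_cast Nat.succ_mul_centralBinom_succ n
      have h2 : ((n : ℝ) + 1) * (catalan n : ℝ) = n.centralBinom := by
        exact_mod_cast succ_mul_catalan_eq_centralBinom n
      have h3 : ((n + 1).centralBinom : ℝ) = 2 * (2 * n + 1) * catalan n := by
        have h0 : (n : ℝ) + 1 ≠ 0 := by positivity
        apply mul_left_cancel₀ h0
        rw [h1, ← h2]
        ring
      rw [Finset.sum_range_succ, ih, h3, ← h2, pow_succ]
      field_simp
      ring
  simp_rw [h]
  simpa using tendsto_centralBinom_div.const_sub 1

/-- The distribution of `X`: `P(X = n) = C_n / (2 * 4^n)`, `n = 0, 1, …`, with `C_n` the `n`-th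
Catalan number. -/
noncomputable def catalanLaw : PMF ℕ :=
  ⟨fun n => ENNReal.ofReal ((catalan n : ℝ) / (2 * 4 ^ n)), by
    have h := ENNReal.ofReal_tsum_of_nonneg
      (f := fun n : ℕ => (catalan n : ℝ) / (2 * 4 ^ n)) (fun n => by positivity)
      hasSum_catalan.summable
    rw [hasSum_catalan.tsum_eq, ENNReal.ofReal_one] at h
    rw [h]
    exact ENNReal.summable.hasSum⟩

/-! ### Words of binary trees -/

/-! In a 231-avoiding word, every letter before the largest letter is smaller than every letter
after it, since otherwise these two and the largest would form 231. Cutting at the largest letter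
therefore identifies the 231-avoiding images of a block of length `n` with the binary trees with `n`
nodes (`treeImage_bijective`, `permImage_bijective`). In a uniform tree with `n + 1` nodes the left
subtree has `i` nodes with probability `C_i C_{n-i} / C_{n+1}`.

For fixed `i` this tends to `C_i / 4^(i+1)`, of total mass 1/2. By symmetry the other half of the
mass sits at `i = n - j` with `j` bounded, and the middle is negligible. At the left end, the word
starts with a finite uniform block, then a letter that tends to `∞`, then a uniform word on the
remaining letters. At the right end, the first letters are those of a uniform word of size `n - j`.
So the average `x` of a functional of the first letters satisfies, asymptotically, `x (n + 1) ≈ z /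
2 + x (n - j) / 2`, where `z` is the mean over a first block of law `C_i / (2 * 4^i)` followed by
`∞` and a fresh start. Hence the upper limit of `|x n - z|` is at most half of itself, and `x` tends
to `z` (`tendsto_of_catalan_recursion`). Each step uses up at least the letter `∞`, so induction on
the number of observed letters gives the limit of all such averages (`tendsto_treeAverage`).

The limit is the expectation under the law of `Z`: its block trees are independent, each equal to a
given tree with probability `1 / (2 * 4^nodes)` (`measure_prefixEvent`, `integral_blocksPrefix`).
Since `S(ℕ, ℕ*)` is compact, a continuous function is uniformly close to one that reads finitely
many letters and merges the large ones with `∞`, so weak convergence follows. Surjectivity holds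
because infinitely many blocks are non-empty, and the infinite mean because `n C_n / 4^n` is at
least of order `1 / n`. -/

/-- The in-order word of a binary tree: the root carries the largest letter, the left subtree the
smallest ones. The letters are `s + 1, …, s + t.numNodes`. -/
def treeWord : ℕ → BinaryTree Unit → List ℕ+
  | _, .nil => []
  | s, .node _ l r =>
    treeWord s l ++ (s + l.numNodes + r.numNodes).succPNat :: treeWord (s + l.numNodes) r

theorem length_treeWord (s : ℕ) (t : BinaryTree Unit) : (treeWord s t).length = t.numNodes := by
  induction t generalizing s with
  | nil => rfl
  | node _ l r hl hr => simp [treeWord, hl, hr, add_assoc]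

theorem mem_treeWord {s : ℕ} {t : BinaryTree Unit} {k : ℕ+} :
    k ∈ treeWord s t ↔ s + 1 ≤ (k : ℕ) ∧ (k : ℕ) ≤ s + t.numNodes := by
  induction t generalizing s with
  | nil => simp [treeWord]
  | node _ l r hl hr =>
    have h : ∀ a : ℕ, k = a.succPNat ↔ (k : ℕ) = a + 1 := fun a => by
      rw [← PNat.coe_inj, Nat.succPNat_coe]
    simp only [treeWord, List.mem_append, List.mem_cons, hl, hr, h, BinaryTree.numNodes]
    omega

theorem nodup_treeWord (s : ℕ) (t : BinaryTree Unit) : (treeWord s t).Nodup := by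
  induction t generalizing s with
  | nil => simp [treeWord]
  | node _ l r hl hr =>
    rw [treeWord, List.nodup_append, List.nodup_cons]
    refine ⟨hl s, ⟨fun h => ?_, hr _⟩, ?_⟩
    · have := (mem_treeWord.1 h).2
      simp at this
    · rintro a ha b hb rfl
      have h1 := mem_treeWord.1 ha
      rcases List.mem_cons.1 hb with hb | hb
      · rw [hb, Nat.succPNat_coe] at h1
        omega
      · have h2 := mem_treeWord.1 hb
        omega

/-- The pattern `231` does not occur in the word `w`, in terms of subwords. -/
def Avoids231 (w : List ℕ+) : Prop :=
  ∀ a b c, [a, b, c].Sublist w → c < a → a < b → False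

theorem avoids_pattern231_iff {w : List ℕ+} : Avoids w.get pattern231 ↔ Avoids231 w := by
  constructor
  · intro h a b c hs hca hab
    obtain ⟨f, hf⟩ := List.sublist_iff_exists_fin_orderEmbedding_get_eq.1 hs
    refine h ⟨f, f.strictMono, ?_⟩
    intro j k
    have hcb := hca.trans hab
    change w.get (f j) < w.get (f k) ↔ _
    rw [← hf, ← hf]
    fin_cases j <;> fin_cases k <;> simp [pattern231, hca, hab, hcb, hca.le, hab.le, hcb.le]
  · rintro h ⟨f, hf, hp⟩
    refine h (w.get (f 0)) (w.get (f 1)) (w.get (f 2)) ?_ ((hp 2 0).2 (by decide))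
      ((hp 0 1).2 (by decide))
    refine List.sublist_iff_exists_fin_orderEmbedding_get_eq.2
      ⟨OrderEmbedding.ofStrictMono f hf, ?_⟩
    intro ix
    fin_cases ix <;> rfl

theorem Avoids231.sublist {w w' : List ℕ+} (h : Avoids231 w') (hs : w.Sublist w') :
    Avoids231 w :=
  fun a b c h1 => h a b c (h1.trans hs)

/-- An occurrence of 231 cannot use both sides: its last letter is smaller than its first, while the
letters of `m :: R` exceed those of `L`. It cannot start at `m` either, which is the maximum. -/
theorem Avoids231.append_cons {L R : List ℕ+} {m : ℕ+} (hL : Avoids231 L) (hR : Avoids231 R)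
    (hLm : ∀ a ∈ L, a < m) (hRm : ∀ a ∈ R, a < m) (hLR : ∀ a ∈ L, ∀ b ∈ R, a < b) :
    Avoids231 (L ++ m :: R) := by
  intro a b c hs hca hab
  obtain ⟨l1, l2, h, h1, h2⟩ := List.sublist_append_iff.1 hs
  have hmem : ∀ x ∈ l2, x = m ∨ x ∈ R := fun x hx => List.mem_cons.1 (h2.subset hx)
  -- Cases on how many of the three letters fall in `L`.
  rcases l1 with _ | ⟨x, _ | ⟨y, _ | ⟨z, l⟩⟩⟩
  · simp only [List.nil_append] at h
    subst h
    rcases List.sublist_cons_iff.1 h2 with h2 | ⟨r, hr, h2⟩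
    · exact hR a b c h2 hca hab
    · simp only [List.cons.injEq] at hr
      obtain ⟨rfl, rfl⟩ := hr
      exact lt_asymm hab (hRm b (h2.subset (by simp)))
  · simp only [List.cons_append, List.nil_append, List.cons.injEq] at h
    obtain ⟨rfl, rfl⟩ := h
    have ha : a ∈ L := h1.subset (by simp)
    rcases hmem c (by simp) with rfl | hc
    · exact lt_asymm hca (hLm a ha)
    · exact lt_asymm hca (hLR a ha c hc)
  · simp only [List.cons_append, List.nil_append, List.cons.injEq] at h
    obtain ⟨rfl, rfl, rfl⟩ := h
    have ha : a ∈ L := h1.subset (by simp)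
    rcases hmem c (by simp) with rfl | hc
    · exact lt_asymm hca (hLm a ha)
    · exact lt_asymm hca (hLR a ha c hc)
  · simp only [List.cons_append, List.cons.injEq] at h
    obtain ⟨rfl, rfl, rfl, h⟩ := h
    obtain ⟨rfl, rfl⟩ := List.append_eq_nil_iff.1 h.symm
    exact hL a b c h1 hca hab

theorem avoids231_treeWord (s : ℕ) (t : BinaryTree Unit) : Avoids231 (treeWord s t) := by
  induction t generalizing s with
  | nil => intro a b c h; simp [treeWord] at h
  | node _ l r hl hr =>
    refine (hl s).append_cons (hr _) ?_ ?_ ?_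
    · intro a ha
      rw [← PNat.coe_lt_coe, Nat.succPNat_coe]
      have := mem_treeWord.1 ha
      omega
    · intro a ha
      rw [← PNat.coe_lt_coe, Nat.succPNat_coe]
      have := mem_treeWord.1 ha
      omega
    · intro a ha b hb
      rw [← PNat.coe_lt_coe]
      have h1 := mem_treeWord.1 ha
      have h2 := mem_treeWord.1 hb
      omega

/-- The root is recovered as the position of the largest letter, and the two sides of it determine
the subtrees. -/
theorem treeWord_injective (s : ℕ) : Function.Injective (treeWord s) := by
  intro t
  induction t generalizing s with
  | nil =>
    intro t' h
    cases t' with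
    | nil => rfl
    | node _ l r => simp [treeWord] at h
  | node u l r hl hr =>
    intro t' h
    have hlen := congrArg List.length h
    rw [length_treeWord, length_treeWord] at hlen
    cases t' with
    | nil => simp at hlen
    | node u' l' r' =>
      simp only [BinaryTree.numNodes] at hlen
      have hm : s + l'.numNodes + r'.numNodes = s + l.numNodes + r.numNodes := by omega
      have hnd := nodup_treeWord s (.node u l r)
      simp only [treeWord] at h hnd
      rw [hm] at h
      have h1 : (s + l.numNodes + r.numNodes).succPNat ∉ treeWord s l := fun h' => by
        have := mem_treeWord.1 h'
        rw [Nat.succPNat_coe] at this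
        omega
      have h2 : (s + l.numNodes + r.numNodes).succPNat ∉ treeWord s l' := fun h' => by
        have := mem_treeWord.1 h'
        rw [Nat.succPNat_coe] at this
        omega
      -- If one left part were strictly longer than the other, it would contain the root letter.
      have h3 : treeWord s l = treeWord s l' ∧
          treeWord (s + l.numNodes) r = treeWord (s + l'.numNodes) r' := by
        rcases List.append_eq_append_iff.1 h with ⟨as, ha, hb⟩ | ⟨as, ha, hb⟩
        · cases as with
          | nil => simp_all
          | cons x as =>
            simp only [List.cons_append, List.cons.injEq] at hb
            refine absurd ?_ h2
            rw [ha, hb.1]; simp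
        · cases as with
          | nil => simp_all
          | cons x as =>
            simp only [List.cons_append, List.cons.injEq] at hb
            refine absurd ?_ h1
            rw [ha, hb.1]; simp
      have hl' := hl s h3.1
      subst hl'
      rw [hr _ h3.2]

/-- Cutting at the largest letter leaves two avoiding words. All letters on the left are below those
on the right, so each side is again the word of a block and strong induction applies. -/
theorem exists_treeWord_eq (n s : ℕ) (w : List ℕ+) (hnd : w.Nodup)
    (hmem : ∀ k : ℕ+, k ∈ w ↔ s + 1 ≤ (k : ℕ) ∧ (k : ℕ) ≤ s + n) (hav : Avoids231 w) :
    ∃ t : BinaryTree Unit, t.numNodes = n ∧ treeWord s t = w := by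
  induction n using Nat.strong_induction_on generalizing s w with
  | _ n ih =>
  cases n with
  | zero =>
    refine ⟨.nil, rfl, ?_⟩
    symm
    rw [treeWord, List.eq_nil_iff_forall_not_mem]
    intro k hk
    have := (hmem k).1 hk
    omega
  | succ n =>
    have hm : (s + n).succPNat ∈ w := by
      rw [hmem, Nat.succPNat_coe]
      omega
    obtain ⟨L, R, rfl⟩ := List.append_of_mem hm
    rw [List.nodup_append, List.nodup_cons] at hnd
    obtain ⟨hL, ⟨hmR, hR⟩, hdis⟩ := hnd
    have hmem' : ∀ k : ℕ+, k ∈ L ∨ k ∈ R ↔ s + 1 ≤ (k : ℕ) ∧ (k : ℕ) ≤ s + n := by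
      intro k
      have h1 := hmem k
      by_cases hk : k = (s + n).succPNat
      · have h3 : k ∉ L := fun h => hdis k h _ (by simp) hk
        have h4 : k ∉ R := hk ▸ hmR
        have h5 : (k : ℕ) = s + n + 1 := by rw [hk, Nat.succPNat_coe]
        simp only [h3, h4, or_self, false_iff]
        omega
      · have h5 : (k : ℕ) ≠ s + n + 1 := fun h => hk (by
          rw [← PNat.coe_inj, Nat.succPNat_coe, h])
        simp only [List.mem_append, List.mem_cons, hk, false_or] at h1
        rw [h1]
        omega
    have hLR : ∀ a ∈ L, ∀ b ∈ R, a < b := by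
      intro a ha b hb
      by_contra! hab
      have hne : a ≠ b := hdis a ha b (by simp [hb])
      refine hav a (s + n).succPNat b ?_ (lt_of_le_of_ne hab hne.symm) ?_
      · have h1 : [a].Sublist L := List.singleton_sublist.2 ha
        have h2 : [(s + n).succPNat, b].Sublist ((s + n).succPNat :: R) :=
          (List.singleton_sublist.2 hb).cons_cons _
        exact h1.append h2
      · rw [← PNat.coe_lt_coe, Nat.succPNat_coe]
        have := (hmem' a).1 (Or.inl ha)
        omega
    -- The threshold between the two sides: `s + i` is the largest letter of `L`, with `i = 0` when
    -- `L` is empty.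
    obtain ⟨i, hin, hi1, hi2⟩ : ∃ i, i ≤ n ∧ (∀ k ∈ L, (k : ℕ) ≤ s + i) ∧
        ∀ k ∈ R, s + i < (k : ℕ) := by
      rcases L.toFinset.eq_empty_or_nonempty with h | h
      · rw [List.toFinset_eq_empty_iff] at h
        subst h
        refine ⟨0, Nat.zero_le _, by simp, fun k hk => ?_⟩
        have := (hmem' k).1 (Or.inr hk)
        omega
      · obtain ⟨a, ha, hmax⟩ := Finset.exists_max_image _ id h
        rw [List.mem_toFinset] at ha
        have h1 := (hmem' a).1 (Or.inl ha)
        refine ⟨a - s, by omega, fun k hk => ?_, fun k hk => ?_⟩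
        · have := PNat.coe_le_coe _ _ |>.2 (hmax k (List.mem_toFinset.2 hk))
          simp only [id] at this
          omega
        · have := PNat.coe_lt_coe _ _ |>.2 (hLR a ha k hk)
          omega
    obtain ⟨l, hl, rfl⟩ := ih i (by omega) s L hL (fun k => by
        constructor
        · intro hk
          exact ⟨((hmem' k).1 (Or.inl hk)).1, hi1 k hk⟩
        · intro hk
          refine ((hmem' k).2 ⟨hk.1, by omega⟩).resolve_right fun h => ?_
          have := hi2 k h
          omega) (hav.sublist (List.sublist_append_left _ _))
    obtain ⟨r, hr, rfl⟩ := ih (n - i) (by omega) (s + i) R hR (fun k => by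
        constructor
        · intro hk
          have h1 := ((hmem' k).1 (Or.inr hk))
          have h2 := hi2 k hk
          omega
        · intro hk
          refine ((hmem' k).2 ⟨by omega, by omega⟩).resolve_left fun h => ?_
          have := hi1 k h
          omega) (hav.sublist ((List.sublist_cons_self _ _).trans (List.sublist_append_right _ _)))
    refine ⟨.node () l r, by simp only [BinaryTree.numNodes]; omega, ?_⟩
    rw [treeWord]
    congr 3 <;> omega

theorem avoidingImage_mem {I : Finset ℕ+} (w : AvoidingImage pattern231 I) {k : ℕ+} :
    k ∈ w.1 ↔ k ∈ I := by
  rw [← List.mem_toFinset, w.2.2.1]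

/-- The word of a tree with `n` nodes as an avoiding permutation image of `[s + 1, s + n]`. -/
def treeImage (s n : ℕ) (t : BinaryTree.treesOfNumNodesEq n) :
    AvoidingImage pattern231 (blockIcc s (s + n)) :=
  ⟨treeWord s t.1, nodup_treeWord s t.1, by
    ext k
    rw [List.mem_toFinset, mem_treeWord, mem_blockIcc, BinaryTree.mem_treesOfNumNodesEq.1 t.2],
    avoids_pattern231_iff.2 (avoids231_treeWord s t.1)⟩

theorem treeImage_bijective (s n : ℕ) : Function.Bijective (treeImage s n) := by
  constructor
  · intro t t' h
    exact Subtype.ext (treeWord_injective s (congrArg Subtype.val h))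
  · intro w
    obtain ⟨t, ht, h⟩ := exists_treeWord_eq n s w.1 w.2.1
      (fun k => (avoidingImage_mem w).trans mem_blockIcc) (avoids_pattern231_iff.1 w.2.2.2)
    exact ⟨⟨t, BinaryTree.mem_treesOfNumNodesEq.2 ht⟩, Subtype.ext h⟩

theorem card_avoidingImage (s n : ℕ) :
    Fintype.card (AvoidingImage pattern231 (blockIcc s (s + n))) = catalan n := by
  rw [← Fintype.card_of_bijective (treeImage_bijective s n), Fintype.card_coe,
    BinaryTree.treesOfNumNodesEq_card_eq_catalan]

/-- The word `σ_1 ⋯ σ_n` of a permutation. -/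
def permWord {n : ℕ} (σ : Equiv.Perm (Fin n)) : List ℕ+ :=
  List.ofFn fun i => (σ i : ℕ).succPNat

theorem Avoids.comp_iff {α β : Type*} [LinearOrder α] [LinearOrder β] {n m : ℕ} {w : Fin n → α}
    {τ : Fin m → ℕ} {g : α → β} (hg : StrictMono g) : Avoids (g ∘ w) τ ↔ Avoids w τ := by
  simp only [Avoids, Function.comp_apply, hg.lt_iff_lt]

theorem avoids_get_ofFn {α : Type*} [LT α] {n m : ℕ} {w : Fin n → α} {τ : Fin m → ℕ} :
    Avoids (List.ofFn w).get τ ↔ Avoids w τ := by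
  rw [Avoids, Avoids, not_iff_not]
  constructor
  · rintro ⟨f, hf, h⟩
    refine ⟨fun i => Fin.cast (by simp) (f i), fun i j hij => hf hij, fun j k => ?_⟩
    rw [← h j k, List.get_ofFn, List.get_ofFn]
  · rintro ⟨f, hf, h⟩
    refine ⟨fun i => Fin.cast (by simp) (f i), fun i j hij => hf hij, fun j k => ?_⟩
    rw [← h j k]
    simp

/-- The word of an avoiding permutation as an avoiding permutation image of `[1, n]`. -/
def permImage {n : ℕ} (σ : AvoidingPerm pattern231 n) :
    AvoidingImage pattern231 (blockIcc 0 (0 + n)) :=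
  ⟨permWord σ.1, List.nodup_ofFn.2 (fun i j h =>
      σ.1.injective (Fin.ext (Nat.succPNat_injective h))), by
    ext k
    rw [List.mem_toFinset, mem_blockIcc, permWord, List.mem_ofFn]
    constructor
    · rintro ⟨i, rfl⟩
      rw [Nat.succPNat_coe]
      have := (σ.1 i).2
      omega
    · intro hk
      refine ⟨σ.1.symm ⟨k.natPred, ?_⟩, ?_⟩
      · have := PNat.natPred_add_one k
        omega
      · simp, by
    rw [permWord, avoids_get_ofFn]
    exact (Avoids.comp_iff (g := fun i : Fin n => (i : ℕ).succPNat)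
      (fun i j hij => Nat.succPNat_lt_succPNat.2 hij)).2 σ.2⟩

theorem permImage_bijective (n : ℕ) : Function.Bijective (permImage (n := n)) := by
  constructor
  · intro σ τ h
    have h1 : permWord σ.1 = permWord τ.1 := congrArg Subtype.val h
    rw [permWord, permWord, List.ofFn_inj] at h1
    refine Subtype.ext (Equiv.ext fun i => Fin.ext ?_)
    exact Nat.succPNat_injective (congrFun h1 i)
  · rintro ⟨w, hnd, hw, hav⟩
    have hmem : ∀ k : ℕ+, k ∈ w ↔ 0 + 1 ≤ (k : ℕ) ∧ (k : ℕ) ≤ 0 + n := fun k => by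
      rw [← List.mem_toFinset, hw, mem_blockIcc]
    obtain ⟨t, ht, rfl⟩ := exists_treeWord_eq n 0 w hnd hmem (avoids_pattern231_iff.1 hav)
    have hlen : (treeWord 0 t).length = n := by rw [length_treeWord, ht]
    let f : Fin n → Fin n := fun i => ⟨((treeWord 0 t)[i]'(by omega)).natPred, by
      have h1 := ((hmem ((treeWord 0 t)[i]'(by omega))).1 (List.getElem_mem _)).2
      have h2 := PNat.natPred_add_one ((treeWord 0 t)[i]'(by omega))
      omega⟩
    have hf : Function.Injective f := by
      intro i j h
      have h1 := PNat.natPred_injective (Fin.ext_iff.1 h)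
      exact Fin.ext ((List.Nodup.getElem_inj_iff hnd).1 h1)
    let σ : Equiv.Perm (Fin n) := Equiv.ofBijective f (Finite.injective_iff_bijective.1 hf)
    have hσ : permWord σ = treeWord 0 t := by
      refine List.ext_getElem (by simp [permWord, hlen]) fun i h1 h2 => ?_
      simp [permWord, σ, f]
    have hσav : Avoids σ pattern231 := by
      rw [← hσ, permWord, avoids_get_ofFn] at hav
      exact (Avoids.comp_iff (g := fun i : Fin n => (i : ℕ).succPNat)
        (fun i j hij => Nat.succPNat_lt_succPNat.2 hij)).1 hav
    exact ⟨⟨σ, hσav⟩, Subtype.ext hσ⟩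

theorem card_avoidingPerm (n : ℕ) : Fintype.card (AvoidingPerm pattern231 n) = catalan n := by
  rw [Fintype.card_of_bijective (permImage_bijective n), card_avoidingImage]

/-- Permutations and trees are both in bijection with the avoiding images of `[1, n]`, and both
bijections preserve the word. -/
theorem sum_avoidingPerm (n : ℕ) (g : List ℕ+ → ℝ) :
    ∑ σ : AvoidingPerm pattern231 n, g (permWord σ.1) =
      ∑ t ∈ BinaryTree.treesOfNumNodesEq n, g (treeWord 0 t) := by
  have h1 := Fintype.sum_bijective _ (permImage_bijective n)
    (fun σ : AvoidingPerm pattern231 n => g (permWord σ.1))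
    (fun w : AvoidingImage pattern231 (blockIcc 0 (0 + n)) => g w.1) fun _ => rfl
  have h2 := Fintype.sum_bijective _ (treeImage_bijective 0 n) (fun t => g (treeWord 0 t.1))
    (fun w : AvoidingImage pattern231 (blockIcc 0 (0 + n)) => g w.1) fun _ => rfl
  exact h1.trans (h2.symm.trans (Finset.sum_coe_sort _ (fun t => g (treeWord 0 t))))

/-! ### Asymptotics of Catalan numbers -/

theorem catalan_pos (n : ℕ) : 0 < catalan n := by
  rw [← BinaryTree.treesOfNumNodesEq_card_eq_catalan, Finset.card_pos]
  exact ⟨(treeImage_bijective 0 n).2 (Classical.arbitrary _) |>.choose.1, Subtype.property _⟩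

theorem succ_succ_mul_catalan_succ (n : ℕ) :
    ((n : ℝ) + 2) * (catalan (n + 1) : ℝ) = 2 * (2 * n + 1) * catalan n := by
  have h1 : ((n : ℝ) + 1) * ((n + 1).centralBinom : ℝ) = 2 * (2 * n + 1) * n.centralBinom := by
    exact_mod_cast Nat.succ_mul_centralBinom_succ n
  have h2 : ((n : ℝ) + 1) * (catalan n : ℝ) = n.centralBinom := by
    exact_mod_cast succ_mul_catalan_eq_centralBinom n
  have h3 : ((n : ℝ) + 1 + 1) * (catalan (n + 1) : ℝ) = (n + 1).centralBinom := by
    exact_mod_cast succ_mul_catalan_eq_centralBinom (n + 1)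
  have h0 : (n : ℝ) + 1 ≠ 0 := by positivity
  apply mul_left_cancel₀ h0
  linear_combination ((n : ℝ) + 1) * h3 + h1 - 2 * (2 * n + 1) * h2

theorem tendsto_catalan_div_succ :
    Tendsto (fun n : ℕ => (catalan n : ℝ) / catalan (n + 1)) atTop (𝓝 (1 / 4)) := by
  -- The ratio is `(n + 2) / (4n + 2)`, written as its limit plus a remainder.
  have h : ∀ n : ℕ, (catalan n : ℝ) / catalan (n + 1) = 1 / 4 + 3 / 8 * (1 / ((n : ℝ) + 1 / 2)) := by
    intro n
    have h1 := succ_succ_mul_catalan_succ n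
    have h2 : (catalan (n + 1) : ℝ) ≠ 0 := by exact_mod_cast (catalan_pos _).ne'
    have h3 : (n : ℝ) + 1 / 2 ≠ 0 := by positivity
    field_simp
    linear_combination -16 * h1
  simp_rw [h]
  have h4 : Tendsto (fun n : ℕ => (n : ℝ) + 1 / 2) atTop atTop :=
    tendsto_atTop_add_const_right _ _ tendsto_natCast_atTop_atTop
  have h5 := (h4.inv_tendsto_atTop.const_mul (3 / 8)).const_add (1 / 4)
  simpa using h5

theorem tendsto_catalan_div_add (k : ℕ) :
    Tendsto (fun n : ℕ => (catalan n : ℝ) / catalan (n + k)) atTop (𝓝 (1 / 4 ^ k)) := by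
  induction k with
  | zero =>
    have h : ∀ n : ℕ, (catalan n : ℝ) / catalan (n + 0) = 1 := fun n =>
      div_self (by exact_mod_cast (catalan_pos _).ne')
    simp only [h, pow_zero, div_one]
    exact tendsto_const_nhds
  | succ k ih =>
    have h1 := ih.mul (tendsto_catalan_div_succ.comp (tendsto_add_atTop_nat k))
    convert h1 using 2
    · rename_i n
      have h2 : (catalan (n + k) : ℝ) ≠ 0 := by exact_mod_cast (catalan_pos _).ne'
      simp only [Function.comp]
      rw [div_mul_div_cancel₀ h2, add_assoc]
    · rw [pow_succ]; ring

/-- The probability that the left subtree of a uniform binary tree with `n + 1` nodes has `i`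
nodes (for `i ≤ n`). -/
noncomputable def leftWeight (n i : ℕ) : ℝ :=
  (catalan i : ℝ) * catalan (n - i) / catalan (n + 1)

theorem leftWeight_nonneg (n i : ℕ) : 0 ≤ leftWeight n i := by
  unfold leftWeight; positivity

theorem leftWeight_symm {n i : ℕ} (h : i ≤ n) : leftWeight n (n - i) = leftWeight n i := by
  unfold leftWeight
  rw [Nat.sub_sub_self h, mul_comm (catalan i : ℝ)]

theorem sum_leftWeight (n : ℕ) : ∑ i ∈ Finset.range (n + 1), leftWeight n i = 1 := by
  have h2 : (catalan (n + 1) : ℝ) ≠ 0 := by exact_mod_cast (catalan_pos _).ne'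
  unfold leftWeight
  rw [← Finset.sum_div, div_eq_one_iff_eq h2, catalan_succ', Nat.cast_sum,
    Finset.Nat.sum_antidiagonal_eq_sum_range_succ_mk]
  simp

theorem tendsto_leftWeight (i : ℕ) :
    Tendsto (fun n => leftWeight n i) atTop (𝓝 ((catalan i : ℝ) / (4 * 4 ^ i))) := by
  rw [← tendsto_add_atTop_iff_nat i]
  have h := (tendsto_catalan_div_add (i + 1)).const_mul (catalan i : ℝ)
  convert h using 2
  · rename_i n
    rw [leftWeight, Nat.add_sub_cancel, mul_div_assoc, add_assoc]
  · rw [pow_succ]; ring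

/-- The limits of the left weights carry only mass 1/2; the missing half is at the right end. -/
theorem hasSum_catalan_div_four_mul :
    HasSum (fun n : ℕ => (catalan n : ℝ) / (4 * 4 ^ n)) (1 / 2) := by
  have h := hasSum_catalan.mul_left (1 / 2)
  rw [mul_one] at h
  have e : (fun n : ℕ => (catalan n : ℝ) / (4 * 4 ^ n)) =
      fun n : ℕ => 1 / 2 * ((catalan n : ℝ) / (2 * 4 ^ n)) := funext fun n => by ring
  rwa [e]

/-- With `ε = D / 4`, every eventual bound `D` improves to `3 D / 4`; iteration gives geometric
decay. -/
theorem tendsto_zero_of_eventually_half {d : ℕ → ℝ} {B : ℝ} (h0 : ∀ n, 0 ≤ d n) (hB : ∀ n, d n ≤ B)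
    (h : ∀ D ε : ℝ, 0 ≤ D → 0 < ε → (∀ᶠ n in atTop, d n ≤ D) → ∀ᶠ n in atTop, d n ≤ D / 2 + ε) :
    Tendsto d atTop (𝓝 0) := by
  have key : ∀ k : ℕ, ∀ᶠ n in atTop, d n ≤ (max B 1) * (3 / 4) ^ k := by
    intro k
    have hM : 0 < max B 1 := lt_max_of_lt_right one_pos
    induction k with
    | zero => exact Eventually.of_forall fun n => by simpa using Or.inl (hB n)
    | succ k ih =>
      have hD : 0 < max B 1 * (3 / 4) ^ k := by positivity
      filter_upwards [h _ (max B 1 * (3 / 4) ^ k / 4) hD.le (by positivity) ih] with n hn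
      rw [pow_succ]
      linarith
  have hlim : Tendsto (fun k : ℕ => (max B 1) * (3 / 4 : ℝ) ^ k) atTop (𝓝 0) := by
    simpa using (tendsto_pow_atTop_nhds_zero_of_lt_one (r := (3 / 4 : ℝ))
      (by norm_num) (by norm_num)).const_mul (max B 1)
  rw [Metric.tendsto_nhds]
  intro ε hε
  obtain ⟨k, hk⟩ := (hlim.eventually (gt_mem_nhds hε)).exists
  filter_upwards [key k] with n hn
  rw [Real.dist_eq, sub_zero, abs_of_nonneg (h0 n)]
  exact hn.trans_lt hk

/-- The last block is indexed by the distance to the right end, to exploit the symmetry of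
`leftWeight`. -/
theorem sum_range_three_blocks (f : ℕ → ℝ) (I R : ℕ) :
    ∑ i ∈ Finset.range (I + R + I), f i = ∑ i ∈ Finset.range I, f i +
      ∑ i ∈ Finset.range R, f (I + i) + ∑ j ∈ Finset.range I, f (I + R + I - 1 - j) := by
  rw [Finset.sum_range_add, Finset.sum_range_add, ← Finset.sum_range_reflect (fun j => f (I + R + j))]
  congr 1
  refine Finset.sum_congr rfl fun j hj => ?_
  have := Finset.mem_range.1 hj
  congr 1
  omega

/-- A recursion for averages over binary trees: `y n i` is the average over the trees with `n + 1`
nodes whose left subtree has `i` nodes. -/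
theorem tendsto_of_catalan_recursion {x : ℕ → ℝ} {y : ℕ → ℕ → ℝ} {Y : ℕ → ℝ} {B : ℝ}
    (hx : ∀ n, |x n| ≤ B) (hy : ∀ n i, i ≤ n → |y n i| ≤ B)
    (hrec : ∀ n, x (n + 1) = ∑ i ∈ Finset.range (n + 1), leftWeight n i * y n i)
    (hleft : ∀ i, Tendsto (fun n => y n i) atTop (𝓝 (Y i)))
    (hright : ∀ j, ∀ᶠ n in atTop, y n (n - j) = x (n - j)) :
    Tendsto x atTop (𝓝 (∑' i, (catalan i : ℝ) / (2 * 4 ^ i) * Y i)) := by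
  set z := ∑' i, (catalan i : ℝ) / (2 * 4 ^ i) * Y i with hz
  have hB : 0 ≤ B := (abs_nonneg _).trans (hx 0)
  have hY : ∀ i, |Y i| ≤ B := fun i => by
    refine le_of_tendsto (hleft i).abs ?_
    filter_upwards [eventually_ge_atTop i] with n hn using hy n i hn
  have hsum : Summable fun i => (catalan i : ℝ) / (2 * 4 ^ i) * Y i := by
    refine Summable.of_norm_bounded (hasSum_catalan.summable.mul_right B) fun i => ?_
    rw [Real.norm_eq_abs, abs_mul, abs_of_nonneg (a := (catalan i : ℝ) / (2 * 4 ^ i)) (by positivity)]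
    exact mul_le_mul_of_nonneg_left (hY i) (by positivity)
  -- The left end contributes only half of `z`, as the limiting left weights are half the law of a
  -- block length.
  have hsum2 : HasSum (fun i => (catalan i : ℝ) / (4 * 4 ^ i) * Y i) (z / 2) := by
    have h := hsum.hasSum.mul_left (1 / 2)
    rw [← hz, one_div_mul_eq_div] at h
    have e : (fun n : ℕ => (catalan n : ℝ) / (4 * 4 ^ n) * Y n) =
        fun n : ℕ => 1 / 2 * ((catalan n : ℝ) / (2 * 4 ^ n) * Y n) := funext fun n => by ring
    rwa [e]
  suffices h : Tendsto (fun n => |x n - z|) atTop (𝓝 0) by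
    rw [tendsto_iff_norm_sub_tendsto_zero]
    exact h
  refine tendsto_zero_of_eventually_half (B := B + |z|) (fun n => abs_nonneg _)
    (fun n => (abs_sub _ _).trans (by gcongr; exact hx n)) ?_
  intro D ε hD hε hev
  -- the bound obtained by cutting the sum at `I`
  let U : ℕ → ℕ → ℝ := fun I n =>
    |∑ i ∈ Finset.range I, leftWeight n i * y n i - z / 2| +
    B * (1 - 2 * ∑ i ∈ Finset.range I, leftWeight n i) +
    D * ∑ i ∈ Finset.range I, leftWeight n i +
    |z| * |∑ i ∈ Finset.range I, leftWeight n i - 1 / 2|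
  let V : ℕ → ℝ := fun I =>
    |∑ i ∈ Finset.range I, (catalan i : ℝ) / (4 * 4 ^ i) * Y i - z / 2| +
    B * (1 - 2 * ∑ i ∈ Finset.range I, (catalan i : ℝ) / (4 * 4 ^ i)) +
    D * ∑ i ∈ Finset.range I, (catalan i : ℝ) / (4 * 4 ^ i) +
    |z| * |∑ i ∈ Finset.range I, (catalan i : ℝ) / (4 * 4 ^ i) - 1 / 2|
  have hUV : ∀ I, Tendsto (U I) atTop (𝓝 (V I)) := by
    intro I
    have h1 : Tendsto (fun n => ∑ i ∈ Finset.range I, leftWeight n i) atTop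
        (𝓝 (∑ i ∈ Finset.range I, (catalan i : ℝ) / (4 * 4 ^ i))) :=
      tendsto_finsetSum _ fun i _ => tendsto_leftWeight i
    have h2 : Tendsto (fun n => ∑ i ∈ Finset.range I, leftWeight n i * y n i) atTop
        (𝓝 (∑ i ∈ Finset.range I, (catalan i : ℝ) / (4 * 4 ^ i) * Y i)) :=
      tendsto_finsetSum _ fun i _ => (tendsto_leftWeight i).mul (hleft i)
    exact (((h2.sub_const _).abs.add (((h1.const_mul 2).const_sub 1).const_mul B)).add
      (h1.const_mul D)).add ((h1.sub_const _).abs.const_mul |z|)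
  -- Only the third term survives: the partial masses tend to 1/2, which kills the error of the left
  -- end, the mass of the middle and the defect `p - 1 / 2` of the right end.
  have hV : Tendsto V atTop (𝓝 (D / 2)) := by
    have h1 := hasSum_catalan_div_four_mul.tendsto_sum_nat
    have h2 := hsum2.tendsto_sum_nat
    have h3 := (((h2.sub_const (z / 2)).abs.add (((h1.const_mul 2).const_sub 1).const_mul B)).add
      (h1.const_mul D)).add ((h1.sub_const (1 / 2)).abs.const_mul |z|)
    convert h3 using 2
    norm_num
    ring
  obtain ⟨I, hI⟩ := (hV.eventually (gt_mem_nhds (show D / 2 < D / 2 + ε by linarith))).exists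
  have hright' : ∀ᶠ n in atTop, ∀ j ∈ Finset.range I, y n (n - j) = x (n - j) :=
    (Finset.eventually_all _).2 fun j _ => hright j
  have hev' : ∀ᶠ n in atTop, ∀ j ∈ Finset.range I, |x (n - j) - z| ≤ D :=
    (Finset.eventually_all _).2 fun j _ => (tendsto_sub_atTop_nat j).eventually hev
  have hmain : ∀ᶠ n in atTop, |x (n + 1) - z| ≤ D / 2 + ε := by
    filter_upwards [hright', hev', (hUV I).eventually (gt_mem_nhds hI), eventually_ge_atTop (2 * I)]
      with n hr hd hU hn
    refine le_trans ?_ hU.le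
    obtain ⟨R, hR⟩ : ∃ R, n + 1 = I + R + I := ⟨n + 1 - 2 * I, by omega⟩
    have hn1 : I + R + I - 1 = n := by omega
    set p := ∑ i ∈ Finset.range I, leftWeight n i with hp
    have hlast : ∑ j ∈ Finset.range I, leftWeight n (n - j) = p := by
      refine Finset.sum_congr rfl fun j hj => leftWeight_symm ?_
      have := Finset.mem_range.1 hj
      omega
    have hone := sum_leftWeight n
    rw [hR, sum_range_three_blocks, hn1, hlast, ← hp] at hone
    have hmid : |∑ i ∈ Finset.range R, leftWeight n (I + i) * y n (I + i)| ≤ B * (1 - 2 * p) := by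
      refine (Finset.abs_sum_le_sum_abs _ _).trans ?_
      have h1 : ∑ i ∈ Finset.range R, leftWeight n (I + i) = 1 - 2 * p := by linarith
      rw [← h1, Finset.mul_sum]
      refine Finset.sum_le_sum fun i hi => ?_
      have := Finset.mem_range.1 hi
      rw [abs_mul, abs_of_nonneg (leftWeight_nonneg _ _), mul_comm B]
      exact mul_le_mul_of_nonneg_left (hy n _ (by omega)) (leftWeight_nonneg _ _)
    have hend : |∑ j ∈ Finset.range I, leftWeight n (n - j) * (x (n - j) - z)| ≤ D * p := by
      refine (Finset.abs_sum_le_sum_abs _ _).trans ?_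
      rw [← hlast, Finset.mul_sum]
      refine Finset.sum_le_sum fun j hj => ?_
      rw [abs_mul, abs_of_nonneg (leftWeight_nonneg _ _), mul_comm D]
      exact mul_le_mul_of_nonneg_left (hd j hj) (leftWeight_nonneg _ _)
    have hend2 : ∑ j ∈ Finset.range I, leftWeight n (n - j) * y n (n - j) =
        ∑ j ∈ Finset.range I, leftWeight n (n - j) * (x (n - j) - z) + p * z := by
      rw [← hlast, Finset.sum_mul, ← Finset.sum_add_distrib]
      refine Finset.sum_congr rfl fun j hj => ?_
      rw [hr j hj]
      ring
    -- Left end, middle, right end, and the error made by giving the right end mass `p` instead of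
    -- 1/2.
    have hx1 : x (n + 1) - z = (∑ i ∈ Finset.range I, leftWeight n i * y n i - z / 2) +
        ∑ i ∈ Finset.range R, leftWeight n (I + i) * y n (I + i) +
        ∑ j ∈ Finset.range I, leftWeight n (n - j) * (x (n - j) - z) + z * (p - 1 / 2) := by
      rw [hrec, hR, sum_range_three_blocks, hn1, hend2]
      ring
    rw [hx1]
    refine (abs_add_le _ _).trans (add_le_add ((abs_add_le _ _).trans (add_le_add
      ((abs_add_le _ _).trans (add_le_add le_rfl hmid)) hend)) ?_)
    rw [abs_mul]
  obtain ⟨N, hN⟩ := eventually_atTop.1 hmain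
  filter_upwards [eventually_ge_atTop (N + 1)] with n hn
  obtain ⟨m, rfl⟩ : ∃ m, n = m + 1 := ⟨n - 1, by omega⟩
  exact hN m (by omega)

/-! ### Local functionals of words -/

/-- Replace the letters larger than `M` by `∞`. -/
def truncLetter (M : ℕ) (x : NStar) : NStar :=
  OnePoint.elim x OnePoint.infty fun k : ℕ+ => if (k : ℕ) ≤ M then (k : NStar) else OnePoint.infty

@[simp]
theorem truncLetter_infty (M : ℕ) : truncLetter M OnePoint.infty = OnePoint.infty := rfl

theorem truncLetter_coe (M : ℕ) (k : ℕ+) :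
    truncLetter M k = if (k : ℕ) ≤ M then (k : NStar) else OnePoint.infty := rfl

/-- `h w` depends on the first `K` letters of `w` only, and does not distinguish the letters
larger than `M`. -/
def IsLocal (K M : ℕ) (h : List NStar → ℝ) : Prop :=
  ∀ w w' : List NStar,
    (w.map (truncLetter M)).take K = (w'.map (truncLetter M)).take K → h w = h w'

/-- The word of a tree, as a word over `ℕ*`. -/
def treeLetters (s : ℕ) (t : BinaryTree Unit) : List NStar :=
  (treeWord s t).map fun k : ℕ+ => (k : NStar)

theorem length_treeLetters (s : ℕ) (t : BinaryTree Unit) :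
    (treeLetters s t).length = t.numNodes := by
  rw [treeLetters, List.length_map, length_treeWord]

/-- The functional `w ↦ h (u * ∞ * w)`, where `u` is the word of `t`. -/
def prependBlock (s : ℕ) (t : BinaryTree Unit) (h : List NStar → ℝ) : List NStar → ℝ :=
  fun w => h (treeLetters s t ++ OnePoint.infty :: w)

/-- The separating `∞` occupies one position even when the block is empty, so at least one of the `K
+ 1` observed letters is used up. -/
theorem IsLocal.prependBlock {K M : ℕ} {h : List NStar → ℝ} (hh : IsLocal (K + 1) M h) (s : ℕ)
    (t : BinaryTree Unit) : IsLocal K M (prependBlock s t h) := by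
  intro w w' hw
  apply hh
  rw [List.map_append, List.map_append, List.take_append, List.take_append, List.map_cons,
    List.map_cons]
  congr 1
  obtain ⟨j, hj, hjK⟩ : ∃ j, K + 1 - (List.map (truncLetter M) (treeLetters s t)).length = j ∧
      j ≤ K + 1 := ⟨_, rfl, Nat.sub_le _ _⟩
  rw [hj]
  cases j with
  | zero => rfl
  | succ j =>
    have h1 := congrArg (List.take j) hw
    rw [List.take_take, List.take_take, min_eq_left (by omega)] at h1
    rw [List.take_succ_cons, List.take_succ_cons, h1]

/-! ### Averages over binary trees and their limits -/

theorem sum_treesOfNumNodesEq_succ (n : ℕ) (g : BinaryTree Unit → ℝ) :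
    ∑ t ∈ BinaryTree.treesOfNumNodesEq (n + 1), g t =
      ∑ i ∈ Finset.range (n + 1), ∑ l ∈ BinaryTree.treesOfNumNodesEq i,
        ∑ r ∈ BinaryTree.treesOfNumNodesEq (n - i), g (.node () l r) := by
  rw [BinaryTree.treesOfNumNodesEq_succ, Finset.sum_biUnion, Finset.Nat.sum_antidiagonal_eq_sum_range_succ_mk]
  · refine Finset.sum_congr rfl fun i _ => ?_
    rw [BinaryTree.pairwiseNode, Finset.sum_map, Finset.sum_product]
    rfl
  · simp_rw [Set.PairwiseDisjoint, Set.Pairwise, Finset.disjoint_left]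
    aesop

/-- The average of `g` over the binary trees with `n` nodes. -/
noncomputable def treeAverage (n : ℕ) (g : BinaryTree Unit → ℝ) : ℝ :=
  (∑ t ∈ BinaryTree.treesOfNumNodesEq n, g t) / catalan n

theorem treeAverage_const (n : ℕ) (b : ℝ) : treeAverage n (fun _ => b) = b := by
  have h : (catalan n : ℝ) ≠ 0 := by exact_mod_cast (catalan_pos n).ne'
  rw [treeAverage, Finset.sum_const, BinaryTree.treesOfNumNodesEq_card_eq_catalan, nsmul_eq_mul]
  field_simp

theorem treeAverage_congr {n : ℕ} {g g' : BinaryTree Unit → ℝ}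
    (h : ∀ t, t.numNodes = n → g t = g' t) : treeAverage n g = treeAverage n g' := by
  rw [treeAverage, treeAverage,
    Finset.sum_congr rfl fun t ht => h t (BinaryTree.mem_treesOfNumNodesEq.1 ht)]

theorem abs_treeAverage_le {n : ℕ} {g : BinaryTree Unit → ℝ} {B : ℝ} (h : ∀ t, |g t| ≤ B) :
    |treeAverage n g| ≤ B := by
  rw [← treeAverage_const n B, treeAverage, treeAverage, abs_div, Nat.abs_cast]
  gcongr
  exact (Finset.abs_sum_le_sum_abs _ _).trans (Finset.sum_le_sum fun t _ => h t)

theorem treeAverage_succ (n : ℕ) (g : BinaryTree Unit → ℝ) :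
    treeAverage (n + 1) g = ∑ i ∈ Finset.range (n + 1), leftWeight n i *
      treeAverage i fun l => treeAverage (n - i) fun r => g (.node () l r) := by
  rw [treeAverage, sum_treesOfNumNodesEq_succ, Finset.sum_div]
  refine Finset.sum_congr rfl fun i _ => ?_
  have h1 : (catalan i : ℝ) ≠ 0 := by exact_mod_cast (catalan_pos i).ne'
  have h2 : (catalan (n - i) : ℝ) ≠ 0 := by exact_mod_cast (catalan_pos (n - i)).ne'
  simp only [treeAverage, leftWeight]
  rw [← Finset.sum_div]
  field_simp

/-- The expectation of the functional `h` of the word `Π_1 * ∞ * ⋯ * Π_K * ∞` with independent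
random blocks, the smallest possible letter being `s + 1`. -/
noncomputable def limitExp : ℕ → ℕ → (List NStar → ℝ) → ℝ
  | 0, _, h => h []
  | K + 1, s, h => ∑' i : ℕ, 1 / (2 * 4 ^ i) *
      ∑ l ∈ BinaryTree.treesOfNumNodesEq i, limitExp K (s + i) (prependBlock s l h)

/-- Induction on the number `K` of observed letters. The Catalan recursion reduces the limit to
fixed left subtrees, after which a functional of one letter fewer is applied to the right subtree.
-/
theorem tendsto_treeAverage {K M : ℕ} {h : List NStar → ℝ} {B : ℝ} (hh : IsLocal K M h)
    (hB : ∀ w, |h w| ≤ B) (s : ℕ) :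
    Tendsto (fun n => treeAverage n fun t => h (treeLetters s t)) atTop (𝓝 (limitExp K s h)) := by
  induction K generalizing s h with
  | zero =>
    have h1 : ∀ w, h w = h [] := fun w => hh _ _ (by simp)
    simp only [h1, treeAverage_const]
    exact tendsto_const_nhds
  | succ K ih =>
    have hlim : limitExp (K + 1) s h = ∑' i : ℕ, (catalan i : ℝ) / (2 * 4 ^ i) *
        treeAverage i fun l => limitExp K (s + i) (prependBlock s l h) := by
      refine tsum_congr fun i => ?_
      have h1 : (catalan i : ℝ) ≠ 0 := by exact_mod_cast (catalan_pos i).ne'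
      rw [treeAverage]
      field_simp
    rw [hlim]
    refine tendsto_of_catalan_recursion (B := B)
      (y := fun n i => treeAverage i fun l => treeAverage (n - i) fun r =>
        h (treeLetters s (.node () l r)))
      (fun n => abs_treeAverage_le fun t => hB _)
      (fun n i _ => abs_treeAverage_le fun l => abs_treeAverage_le fun r => hB _)
      (fun n => treeAverage_succ n _) ?_ ?_
    · intro i
      have h1 : Tendsto (fun n => treeAverage i fun l => treeAverage (n - i) fun r =>
          prependBlock s l h (treeLetters (s + i) r)) atTop
          (𝓝 (treeAverage i fun l => limitExp K (s + i) (prependBlock s l h))) :=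
        (tendsto_finsetSum _ fun l _ => (ih (hh.prependBlock s l) (fun w => hB _) (s + i)).comp
          (tendsto_sub_atTop_nat i)).div_const _
      refine h1.congr' ?_
      -- The root letter is `s + n + 1 > M`, hence indistinguishable from `∞` for `h`.
      filter_upwards [eventually_ge_atTop (M + i)] with n hn
      refine treeAverage_congr fun l hl => treeAverage_congr fun r hr => ?_
      apply hh
      rw [treeLetters, treeLetters, treeLetters, treeWord, hl, hr, List.map_append, List.map_cons,
        List.map_append, List.map_append, List.map_cons, List.map_cons, truncLetter_coe,
        if_neg, truncLetter_infty]
      rw [Nat.succPNat_coe]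
      omega
    · intro j
      -- The left subtree has `n - j ≥ K + 1` nodes, so it contains all the observed letters.
      filter_upwards [eventually_ge_atTop (K + 1 + j)] with n hn
      refine treeAverage_congr fun l hl => ?_
      have h1 : ∀ r, h (treeLetters s (.node () l r)) = h (treeLetters s l) := by
        intro r
        apply hh
        rw [treeLetters, treeWord, List.map_append, List.map_append, ← treeLetters,
          List.take_append_of_le_length]
        rw [List.length_map, length_treeLetters]
        omega
      simp only [h1, treeAverage_const]

/-! ### The trees of the blocks -/

theorem partialSum_succ (x : ℕ → ℕ) (n : ℕ) : partialSum x (n + 1) = partialSum x n + x n :=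
  Finset.sum_range_succ _ _

theorem monotone_partialSum (x : ℕ → ℕ) : Monotone (partialSum x) :=
  monotone_nat_of_le_succ fun n => by rw [partialSum_succ]; exact Nat.le_add_right _ _

theorem partialSum_congr {x y : ℕ → ℕ} {n : ℕ} (h : ∀ k < n, x k = y k) :
    partialSum x n = partialSum y n :=
  Finset.sum_congr rfl fun k hk => h k (Finset.mem_range.1 hk)

theorem exists_blockTree (x : ℕ → ℕ) (π : ∀ I : FiniteBlock, AvoidingImage pattern231 I.1) (k : ℕ) :
    ∃ t : BinaryTree Unit, t.numNodes = x k ∧ treeWord (partialSum x k) t =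
      (π (FiniteBlock.mk' (partialSum x k) (partialSum x (k + 1)))).1 := by
  set w := π (FiniteBlock.mk' (partialSum x k) (partialSum x (k + 1))) with hw
  refine exists_treeWord_eq (x k) (partialSum x k) w.1 w.2.1 (fun j => ?_)
    (avoids_pattern231_iff.1 w.2.2.2)
  rw [avoidingImage_mem w, ← partialSum_succ]
  exact mem_blockIcc

/-- The binary tree of the `k`-th block. -/
noncomputable def blockTree (x : ℕ → ℕ) (π : ∀ I : FiniteBlock, AvoidingImage pattern231 I.1)
    (k : ℕ) : BinaryTree Unit :=
  (exists_blockTree x π k).choose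

theorem blockTree_eq_iff {x : ℕ → ℕ} {π : ∀ I : FiniteBlock, AvoidingImage pattern231 I.1} {k : ℕ}
    {t : BinaryTree Unit} : blockTree x π k = t ↔ x k = t.numNodes ∧
      (π (FiniteBlock.mk' (partialSum x k) (partialSum x (k + 1)))).1 =
        treeWord (partialSum x k) t := by
  have h := (exists_blockTree x π k).choose_spec
  constructor
  · rintro rfl
    exact ⟨h.1.symm, h.2.symm⟩
  · intro h'
    exact treeWord_injective _ (h.2.trans h'.2)

theorem numNodes_blockTree (x : ℕ → ℕ) (π : ∀ I : FiniteBlock, AvoidingImage pattern231 I.1)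
    (k : ℕ) : (blockTree x π k).numNodes = x k :=
  (exists_blockTree x π k).choose_spec.1

theorem regenWord_eq (x : ℕ → ℕ) (π : ∀ I : FiniteBlock, AvoidingImage pattern231 I.1) (k : ℕ) :
    regenWord x π k = treeLetters (0 + partialSum (fun j => (blockTree x π j).numNodes) k)
      (blockTree x π k) ++ [OnePoint.infty] := by
  simp only [numNodes_blockTree, zero_add]
  rw [regenWord, treeLetters]
  exact congrArg (fun w => List.map _ w ++ _) (exists_blockTree x π k).choose_spec.2.symm

/-- The word `u_0 * ∞ * u_1 * ∞ * ⋯ * u_{K-1} * ∞`, where `u_k` is the word of `t k`, the letters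
starting from `s + 1`. -/
def blocksPrefix : ℕ → (ℕ → BinaryTree Unit) → ℕ → List NStar
  | _, _, 0 => []
  | s, t, K + 1 => treeLetters s (t 0) ++
      OnePoint.infty :: blocksPrefix (s + (t 0).numNodes) (fun k => t (k + 1)) K

theorem concatPrefix_succ' {α : Type*} (v : ℕ → List α) (N : ℕ) :
    concatPrefix v (N + 1) = v 0 ++ concatPrefix (fun n => v (n + 1)) N := by
  simp [concatPrefix, List.range_succ_eq_map, List.flatMap_map]

theorem concatPrefix_treeLetters (s : ℕ) (t : ℕ → BinaryTree Unit) (K : ℕ) :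
    concatPrefix (fun k => treeLetters (s + partialSum (fun j => (t j).numNodes) k) (t k) ++
      [OnePoint.infty]) K = blocksPrefix s t K := by
  induction K generalizing s t with
  | zero => rfl
  | succ K ih =>
    rw [concatPrefix_succ', blocksPrefix, ← ih]
    simp [partialSum, Finset.sum_range_succ', add_assoc, add_comm]

theorem concatPrefix_regenWord (x : ℕ → ℕ)
    (π : ∀ I : FiniteBlock, AvoidingImage pattern231 I.1) (K : ℕ) :
    concatPrefix (regenWord x π) K = blocksPrefix 0 (blockTree x π) K := by
  rw [← concatPrefix_treeLetters]
  congr 1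
  exact funext (regenWord_eq x π)

theorem blocksPrefix_congr {s : ℕ} {t t' : ℕ → BinaryTree Unit} {K : ℕ}
    (h : ∀ k < K, t k = t' k) : blocksPrefix s t K = blocksPrefix s t' K := by
  induction K generalizing s t t' with
  | zero => rfl
  | succ K ih =>
    rw [blocksPrefix, blocksPrefix, h 0 (by omega), ih fun k hk => h (k + 1) (by omega)]

/-! ### The law of the trees of the blocks -/

theorem uniform_avoidingImage_apply {s u : ℕ} {t : BinaryTree Unit} (hu : u = s + t.numNodes) :
    (PMF.uniformOfFintype (AvoidingImage pattern231 (FiniteBlock.mk' s u).1)).toMeasure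
      {w | w.1 = treeWord s t} = ENNReal.ofReal (1 / (catalan t.numNodes : ℝ)) := by
  subst hu
  have h : {w : AvoidingImage pattern231 (FiniteBlock.mk' s (s + t.numNodes)).1 |
      w.1 = treeWord s t} = {treeImage s t.numNodes ⟨t, t.mem_treesOfNumNodesEq_numNodes⟩} := by
    ext w
    exact ⟨fun hw => Subtype.ext hw, fun hw => congrArg Subtype.val hw⟩
  have hc := card_avoidingImage s t.numNodes
  have hm := PMF.toMeasure_apply_singleton
    (PMF.uniformOfFintype (AvoidingImage pattern231 (blockIcc s (s + t.numNodes))))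
    (treeImage s t.numNodes ⟨t, t.mem_treesOfNumNodesEq_numNodes⟩) MeasurableSpace.measurableSet_top
  rw [PMF.uniformOfFintype_apply, hc] at hm
  rw [one_div, ENNReal.ofReal_inv_of_pos (by exact_mod_cast catalan_pos _), ENNReal.ofReal_natCast]
  exact (congrArg _ h).trans hm

/-- The restriction to positive lengths is needed: all empty blocks are the same index. -/
theorem FiniteBlock.mk'_injOn (x : ℕ → ℕ) :
    Set.InjOn (fun k => FiniteBlock.mk' (partialSum x k) (partialSum x (k + 1))) {k | 0 < x k} := by
  have key : ∀ j k : ℕ, 0 < x j → j < k →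
      FiniteBlock.mk' (partialSum x j) (partialSum x (j + 1)) ≠
        FiniteBlock.mk' (partialSum x k) (partialSum x (k + 1)) := by
    intro j k hj hjk h
    have h1 : (partialSum x j).succPNat ∈ blockIcc (partialSum x j) (partialSum x (j + 1)) := by
      rw [mem_blockIcc, Nat.succPNat_coe, partialSum_succ]
      omega
    rw [show blockIcc (partialSum x j) (partialSum x (j + 1)) =
      blockIcc (partialSum x k) (partialSum x (k + 1)) from congrArg Subtype.val h,
      mem_blockIcc, Nat.succPNat_coe] at h1
    have h2 := monotone_partialSum x (Nat.succ_le_of_lt hjk)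
    rw [Nat.succ_eq_add_one, partialSum_succ] at h2
    omega
  intro j hj k hk h
  rcases lt_trichotomy j k with hlt | rfl | hlt
  · exact absurd h (key j k hj hlt)
  · rfl
  · exact absurd h.symm (key k j hk hlt)

section Law

variable {Ω : Type*}

/-- The event that the first `m` trees are `t 0, …, t (m - 1)`. -/
def prefixEvent (τ : Ω → ℕ → BinaryTree Unit) (m : ℕ) (t : ℕ → BinaryTree Unit) : Set Ω :=
  {ω | ∀ k < m, τ ω k = t k}

/-- Once the lengths are prescribed, the block endpoints are deterministic. The event thus splits
into one on the lengths and one on images of fixed blocks, to which the independence hypotheses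
apply. -/
theorem prefixEvent_blockTree (X : ℕ → Ω → ℕ)
    (PI : ∀ I : FiniteBlock, Ω → AvoidingImage pattern231 I.1) (m : ℕ) (t : ℕ → BinaryTree Unit) :
    prefixEvent (fun ω => blockTree (fun j => X j ω) (fun I => PI I ω)) m t =
      (⋂ k ∈ Finset.range m, X k ⁻¹' {(t k).numNodes}) ∩
      ⋂ k ∈ Finset.range m, PI (FiniteBlock.mk' (partialSum (fun j => (t j).numNodes) k)
          (partialSum (fun j => (t j).numNodes) (k + 1))) ⁻¹'
        {w | w.1 = treeWord (partialSum (fun j => (t j).numNodes) k) (t k)} := by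
  ext ω
  simp only [prefixEvent, Set.mem_ofPred_eq, Set.mem_inter_iff, Set.mem_iInter, Finset.mem_range,
    Set.mem_preimage, Set.mem_singleton_iff, blockTree_eq_iff, forall_and]
  refine and_congr_right fun h => forall₂_congr fun k hk => ?_
  rw [partialSum_congr (n := k) fun j hj => h j (hj.trans hk),
    partialSum_congr (n := k + 1) fun j hj => h j (by omega)]

variable [MeasurableSpace Ω] {P : Measure Ω}

theorem measure_iInter_blocks
    {PI : ∀ I : FiniteBlock, Ω → AvoidingImage pattern231 I.1} (hPI_meas : ∀ I, Measurable (PI I))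
    (hPI_indep : iIndepFun PI P)
    (hPI_law : ∀ I, P.map (PI I) =
      (PMF.uniformOfFintype (AvoidingImage pattern231 I.1)).toMeasure)
    (m : ℕ) (t : ℕ → BinaryTree Unit) :
    P (⋂ k ∈ Finset.range m, PI (FiniteBlock.mk' (partialSum (fun j => (t j).numNodes) k)
          (partialSum (fun j => (t j).numNodes) (k + 1))) ⁻¹'
        {w | w.1 = treeWord (partialSum (fun j => (t j).numNodes) k) (t k)}) =
      ∏ k ∈ Finset.range m, ENNReal.ofReal (1 / (catalan (t k).numNodes : ℝ)) := by
  set S := partialSum (fun j => (t j).numNodes) with hS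
  let b : ℕ → FiniteBlock := fun k => FiniteBlock.mk' (S k) (S (k + 1))
  have hprob : ∀ k, P (PI (b k) ⁻¹' {w | w.1 = treeWord (S k) (t k)}) =
      ENNReal.ofReal (1 / (catalan (t k).numNodes : ℝ)) := by
    intro k
    rw [← Measure.map_apply (hPI_meas _) trivial, hPI_law]
    exact uniform_avoidingImage_apply (partialSum_succ _ _)
  have htriv : ∀ k, (t k).numNodes = 0 →
      PI (b k) ⁻¹' {w | w.1 = treeWord (S k) (t k)} = Set.univ := by
    intro k hk
    ext ω
    simp only [Set.mem_preimage, Set.mem_ofPred_eq, Set.mem_univ, iff_true]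
    have h1 : treeWord (S k) (t k) = [] := by
      rw [← List.length_eq_zero_iff, length_treeWord, hk]
    rw [h1, List.eq_nil_iff_forall_not_mem]
    intro a ha
    have h2 := mem_blockIcc.1 ((avoidingImage_mem (PI (b k) ω)).1 ha)
    rw [hS, partialSum_succ, hk] at h2
    omega
  -- Empty blocks may repeat the same `PI I`, so independence is used only for the non-empty ones,
  -- which are distinct; the others give the sure event, with factor `1 / C_0 = 1`.
  let F := (Finset.range m).filter fun k => 0 < (t k).numNodes
  have hFset : (⋂ k ∈ Finset.range m, PI (b k) ⁻¹' {w | w.1 = treeWord (S k) (t k)}) =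
      ⋂ k : F, PI (b k) ⁻¹' {w | w.1 = treeWord (S k) (t k)} := by
    ext ω
    simp only [Set.mem_iInter]
    constructor
    · intro h k
      exact h k.1 (Finset.mem_filter.1 k.2).1
    · intro h k hk
      rcases Nat.eq_zero_or_pos (t k).numNodes with h0 | h0
      · rw [htriv k h0]; trivial
      · exact h ⟨k, Finset.mem_filter.2 ⟨hk, h0⟩⟩
  have hinj : Function.Injective fun k : F => b k := fun j k h =>
    Subtype.ext (FiniteBlock.mk'_injOn (fun j => (t j).numNodes) (Finset.mem_filter.1 j.2).2
      (Finset.mem_filter.1 k.2).2 h)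
  have hind := hPI_indep.precomp hinj
  change P (⋂ k ∈ Finset.range m, PI (b k) ⁻¹' {w | w.1 = treeWord (S k) (t k)}) = _
  rw [hFset, hind.meas_iInter fun k => ⟨_, trivial, rfl⟩]
  simp only [hprob]
  rw [Finset.prod_coe_sort F (fun k => ENNReal.ofReal (1 / (catalan (t k).numNodes : ℝ)))]
  refine Finset.prod_subset (Finset.filter_subset _ _) fun k hk hkF => ?_
  have h0 : (t k).numNodes = 0 := by
    by_contra h
    exact hkF (Finset.mem_filter.2 ⟨hk, Nat.pos_of_ne_zero h⟩)
  simp [h0]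

theorem measure_lengths {X : ℕ → Ω → ℕ} (hX_meas : ∀ j, Measurable (X j))
    (hX_indep : iIndepFun X P) (hX_law : ∀ j, P.map (X j) = catalanLaw.toMeasure)
    (m : ℕ) (n : ℕ → ℕ) :
    P (⋂ k ∈ Finset.range m, X k ⁻¹' {n k}) =
      ∏ k ∈ Finset.range m, ENNReal.ofReal ((catalan (n k) : ℝ) / (2 * 4 ^ n k)) := by
  rw [hX_indep.measure_inter_preimage_eq_mul _ fun _ _ => .singleton _]
  refine Finset.prod_congr rfl fun k _ => ?_
  rw [← Measure.map_apply (hX_meas k) (.singleton _), hX_law,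
    PMF.toMeasure_apply_singleton _ _ (.singleton _)]
  rfl

theorem measurableSet_prefixEvent {X : ℕ → Ω → ℕ} (hX_meas : ∀ j, Measurable (X j))
    {PI : ∀ I : FiniteBlock, Ω → AvoidingImage pattern231 I.1} (hPI_meas : ∀ I, Measurable (PI I))
    (m : ℕ) (t : ℕ → BinaryTree Unit) :
    MeasurableSet (prefixEvent (fun ω => blockTree (fun j => X j ω) (fun I => PI I ω)) m t) := by
  rw [prefixEvent_blockTree]
  exact (Finset.measurableSet_biInter _ fun k _ => hX_meas k (.singleton _)).inter
    (Finset.measurableSet_biInter _ fun k _ => hPI_meas _ trivial)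

/-- The Catalan number in the law of the length cancels against the uniform choice among as many
images. -/
theorem measure_prefixEvent {X : ℕ → Ω → ℕ} (hX_meas : ∀ j, Measurable (X j))
    (hX_indep : iIndepFun X P) (hX_law : ∀ j, P.map (X j) = catalanLaw.toMeasure)
    {PI : ∀ I : FiniteBlock, Ω → AvoidingImage pattern231 I.1} (hPI_meas : ∀ I, Measurable (PI I))
    (hPI_indep : iIndepFun PI P)
    (hPI_law : ∀ I, P.map (PI I) =
      (PMF.uniformOfFintype (AvoidingImage pattern231 I.1)).toMeasure)
    (hX_PI : IndepFun (fun ω j => X j ω) (fun ω I => PI I ω) P)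
    (m : ℕ) (t : ℕ → BinaryTree Unit) :
    P.real (prefixEvent (fun ω => blockTree (fun j => X j ω) (fun I => PI I ω)) m t) =
      ∏ k ∈ Finset.range m, 1 / (2 * 4 ^ (t k).numNodes : ℝ) := by
  have h1 : ∀ k, MeasurableSet[MeasurableSpace.comap (fun ω j => X j ω) inferInstance]
      (X k ⁻¹' {(t k).numNodes}) := fun k =>
    ⟨(fun x : ℕ → ℕ => x k) ⁻¹' {(t k).numNodes}, measurable_pi_apply k (.singleton _), rfl⟩
  have h2 : ∀ (I : FiniteBlock) (W : Set (AvoidingImage pattern231 I.1)),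
      MeasurableSet[MeasurableSpace.comap (fun ω I => PI I ω) inferInstance] (PI I ⁻¹' W) :=
    fun I W => ⟨(fun x : ∀ I : FiniteBlock, AvoidingImage pattern231 I.1 => x I) ⁻¹' W,
      measurable_pi_apply I trivial, rfl⟩
  rw [measureReal_def, prefixEvent_blockTree, hX_PI.meas_inter
    (@Finset.measurableSet_biInter _ _ (_) _ _ fun k _ => h1 k)
    (@Finset.measurableSet_biInter _ _ (_) _ _ fun k _ => h2 _ _),
    measure_lengths hX_meas hX_indep hX_law, measure_iInter_blocks hPI_meas hPI_indep hPI_law,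
    ← Finset.prod_mul_distrib, ENNReal.toReal_prod]
  refine Finset.prod_congr rfl fun k _ => ?_
  have h3 : (catalan (t k).numNodes : ℝ) ≠ 0 := by exact_mod_cast (catalan_pos _).ne'
  rw [ENNReal.toReal_mul, ENNReal.toReal_ofReal (by positivity),
    ENNReal.toReal_ofReal (by positivity)]
  field_simp

end Law

/-! ### Expectations of local functionals of the random word -/

instance : Countable (BinaryTree Unit) := by
  have h : (⋃ n : ℕ, {t : BinaryTree Unit | t.numNodes = n}).Countable :=
    Set.countable_iUnion fun n => by
      rw [← BinaryTree.coe_treesOfNumNodesEq]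
      exact Finset.countable_toSet _
  have h2 : (⋃ n : ℕ, {t : BinaryTree Unit | t.numNodes = n}) = Set.univ := by
    ext t; simp
  rw [h2] at h
  exact Set.countable_univ_iff.1 h

/-- There are only countably many prefixes of `K` trees, so every preimage is a countable union of
prefix events. -/
theorem measurable_of_prefix {Ω β : Type*} [MeasurableSpace Ω] [MeasurableSpace β]
    {τ : Ω → ℕ → BinaryTree Unit} (hτ : ∀ m t, MeasurableSet (prefixEvent τ m t)) (K : ℕ)
    {G : (ℕ → BinaryTree Unit) → β} (hG : ∀ t t', (∀ k < K, t k = t' k) → G t = G t') :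
    Measurable fun ω => G (τ ω) := by
  intro S _
  let e : (Fin K → BinaryTree Unit) → ℕ → BinaryTree Unit :=
    fun l k => if h : k < K then l ⟨k, h⟩ else .nil
  have h : (fun ω => G (τ ω)) ⁻¹' S = ⋃ l ∈ {l | G (e l) ∈ S}, prefixEvent τ K (e l) := by
    ext ω
    simp only [Set.mem_preimage, Set.mem_iUnion, Set.mem_ofPred_eq, exists_prop, prefixEvent]
    constructor
    · intro hω
      have h1 : ∀ k < K, τ ω k = e (fun i => τ ω i) k := fun k hk => by simp [e, hk]
      exact ⟨fun i => τ ω i, hG _ _ h1 ▸ hω, h1⟩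
    · rintro ⟨l, hl, h1⟩
      rwa [hG _ _ h1]
  rw [h]
  exact MeasurableSet.biUnion (Set.to_countable _) fun l _ => hτ K (e l)

theorem prefixEvent_update {Ω : Type*} (τ : Ω → ℕ → BinaryTree Unit) (m : ℕ)
    (t : ℕ → BinaryTree Unit) (l : BinaryTree Unit) :
    prefixEvent τ (m + 1) (Function.update t m l) = prefixEvent τ m t ∩ {ω | τ ω m = l} := by
  ext ω
  simp only [prefixEvent, Set.mem_ofPred_eq, Set.mem_inter_iff, Nat.forall_lt_succ_right,
    Function.update_self]
  refine and_congr_left fun _ => forall₂_congr fun k hk => ?_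
  rw [Function.update_of_ne hk.ne]

/-- Conditioning on the next tree reproduces the recursion of `limitExp`. The statement is relative
to a prefix event, with `m` and `t` free, so that the induction can absorb that tree into the
prefix. -/
theorem integral_blocksPrefix {Ω : Type*} [MeasurableSpace Ω] {P : Measure Ω}
    [IsProbabilityMeasure P] {τ : Ω → ℕ → BinaryTree Unit}
    (hτ : ∀ m t, MeasurableSet (prefixEvent τ m t))
    (hP : ∀ m t, P.real (prefixEvent τ m t) =
      ∏ k ∈ Finset.range m, 1 / (2 * 4 ^ (t k).numNodes : ℝ))
    {B : ℝ} (K s : ℕ) {h : List NStar → ℝ} (hB : ∀ w, |h w| ≤ B) (m : ℕ)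
    (t : ℕ → BinaryTree Unit) :
    ∫ ω in prefixEvent τ m t, h (blocksPrefix s (fun k => τ ω (m + k)) K) ∂P =
      P.real (prefixEvent τ m t) * limitExp K s h := by
  induction K generalizing s h m t with
  | zero => simp [blocksPrefix, limitExp]
  | succ K ih =>
    have hint : ∀ A, IntegrableOn
        (fun ω => h (blocksPrefix s (fun k => τ ω (m + k)) (K + 1))) A P := by
      intro A
      refine (Integrable.of_bound (C := B) ?_ (ae_of_all _ fun ω => hB _)).integrableOn
      refine (measurable_of_prefix hτ (m + K + 1)
        (G := fun u => h (blocksPrefix s (fun k => u (m + k)) (K + 1))) ?_).aestronglyMeasurable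
      intro u u' hu
      rw [blocksPrefix_congr fun k hk => hu (m + k) (by omega)]
    have hmeas : ∀ l, MeasurableSet (prefixEvent τ m t ∩ {ω | τ ω m = l}) := fun l => by
      rw [← prefixEvent_update]
      exact hτ _ _
    have hdisj : ∀ l l' : BinaryTree Unit, l ≠ l' →
        Disjoint (prefixEvent τ m t ∩ {ω | τ ω m = l}) (prefixEvent τ m t ∩ {ω | τ ω m = l'}) := by
      intro l l' hl
      refine Set.disjoint_left.2 fun ω h1 h2 => hl ?_
      rw [← h1.2, ← h2.2]
    have hone : ∀ l, ∫ ω in prefixEvent τ m t ∩ {ω | τ ω m = l},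
        h (blocksPrefix s (fun k => τ ω (m + k)) (K + 1)) ∂P =
        P.real (prefixEvent τ m t) * (1 / (2 * 4 ^ l.numNodes) *
          limitExp K (s + l.numNodes) (prependBlock s l h)) := by
      intro l
      have h1 : ∫ ω in prefixEvent τ m t ∩ {ω | τ ω m = l},
          h (blocksPrefix s (fun k => τ ω (m + k)) (K + 1)) ∂P =
          ∫ ω in prefixEvent τ m t ∩ {ω | τ ω m = l},
          prependBlock s l h (blocksPrefix (s + l.numNodes) (fun k => τ ω (m + 1 + k)) K) ∂P := by
        refine setIntegral_congr_fun (hmeas l) fun ω hω => ?_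
        have h2 : τ ω (m + 0) = l := hω.2
        simp only [blocksPrefix, prependBlock, h2, add_assoc, add_comm 1]
      rw [h1, ← prefixEvent_update, ih _ (h := prependBlock s l h) (fun w => hB _), hP, hP, Finset.prod_range_succ,
        Function.update_self, mul_assoc]
      congr 1
      refine Finset.prod_congr rfl fun k hk => ?_
      rw [Function.update_of_ne (Finset.mem_range.1 hk).ne]
    -- Grouped by the number of nodes, to match the series over `i` of finite sums in `limitExp`.
    let E : ℕ → Set Ω := fun i => ⋃ l ∈ BinaryTree.treesOfNumNodesEq i,
      prefixEvent τ m t ∩ {ω | τ ω m = l}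
    have hE : ∀ i ω, ω ∈ E i ↔ ω ∈ prefixEvent τ m t ∧ (τ ω m).numNodes = i := by
      intro i ω
      simp only [E, Set.mem_iUnion, BinaryTree.mem_treesOfNumNodesEq, Set.mem_inter_iff,
        Set.mem_ofPred_eq, exists_prop]
      constructor
      · rintro ⟨l, hl, h1, rfl⟩
        exact ⟨h1, hl⟩
      · rintro ⟨h1, h2⟩
        exact ⟨_, h2, h1, rfl⟩
    have hEu : prefixEvent τ m t = ⋃ i, E i := by
      ext ω
      simp [hE]
    have hsum := hasSum_integral_iUnion (μ := P)
      (f := fun ω => h (blocksPrefix s (fun k => τ ω (m + k)) (K + 1))) (s := E)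
      (fun i => Finset.measurableSet_biUnion _ fun l _ => hmeas l)
      (fun i j hij => Set.disjoint_left.2 fun ω h1 h2 =>
        hij (((hE i ω).1 h1).2.symm.trans ((hE j ω).1 h2).2)) (hint _)
    rw [← hEu] at hsum
    rw [← hsum.tsum_eq, limitExp, ← tsum_mul_left]
    refine tsum_congr fun i => ?_
    rw [integral_biUnion_finset _ (fun l _ => hmeas l) (fun l _ l' _ hl => hdisj l l' hl)
      (fun l _ => hint _), Finset.mul_sum, Finset.mul_sum]
    refine Finset.sum_congr rfl fun l hl => ?_
    rw [hone, BinaryTree.mem_treesOfNumNodesEq.1 hl]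

/-! ### Approximation of continuous functions on `S(ℕ, ℕ*)` by local functionals -/

theorem NStar.tail_coe (k : ℕ+) : NStar.tail k = 2 * (1 / 2 : ℝ) ^ (k : ℕ) := rfl

theorem NStar.tail_infty : NStar.tail OnePoint.infty = 0 := rfl

theorem abs_tail_sub_tail_truncLetter_le (N : ℕ) (x : NStar) :
    |NStar.tail x - NStar.tail (truncLetter N x)| ≤ 2 * (1 / 2 : ℝ) ^ N := by
  induction x using OnePoint.rec with
  | infty => simp
  | coe k =>
    rw [truncLetter_coe]
    split_ifs with h
    · simp
    · rw [NStar.tail_infty, sub_zero, NStar.tail_coe, abs_of_nonneg (by positivity)]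
      gcongr ?_ * ?_
      exact pow_le_pow_of_le_one (by norm_num) (by norm_num) (by omega)

theorem tendsto_truncLetter (x : NStar) :
    Tendsto (fun p : ℕ × NStar => truncLetter p.1 p.2) (atTop ×ˢ 𝓝 x) (𝓝 x) := by
  rw [NStar.isEmbedding_tail.tendsto_nhds_iff]
  have h1 : Tendsto (fun p : ℕ × NStar => NStar.tail p.2) (atTop ×ˢ 𝓝 x) (𝓝 (NStar.tail x)) :=
    (NStar.isEmbedding_tail.continuous.tendsto x).comp tendsto_snd
  have h2 : Tendsto (fun n : ℕ => 2 * (1 / 2 : ℝ) ^ n) atTop (𝓝 0) := by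
    simpa using (tendsto_pow_atTop_nhds_zero_of_lt_one (r := (1 / 2 : ℝ))
      (by norm_num) (by norm_num)).const_mul 2
  have h3 : Tendsto (fun p : ℕ × NStar => NStar.tail p.2 - NStar.tail (truncLetter p.1 p.2))
      (atTop ×ˢ 𝓝 x) (𝓝 0) :=
    squeeze_zero_norm (fun p => abs_tail_sub_tail_truncLetter_le p.1 p.2) (h2.comp tendsto_fst)
  simpa [Function.comp_def] using h1.sub h3

/-! ### Compactness, truncation and measurability in `S(ℕ, ℕ*)` -/

namespace SNStar

theorem isEmbedding_coe : IsEmbedding (fun σ : SNStar => (σ : ℕ+ → NStar)) :=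
  IsEmbedding.subtypeVal

theorem isClosed_range_coe :
    IsClosed {σ : ℕ+ → NStar | ∀ i j, i ≠ j → σ i = σ j → σ i = OnePoint.infty} := by
  simp only [Set.ofPred_forall]
  refine isClosed_iInter fun i => isClosed_iInter fun j => isClosed_iInter fun _ => ?_
  rw [← isOpen_compl_iff]
  -- A violation is a common finite value `k` at `i` and `j`, an open condition because finite
  -- points of `ℕ*` are isolated.
  have h : {σ : ℕ+ → NStar | σ i = σ j → σ i = OnePoint.infty}ᶜ =
      ⋃ k : ℕ+, {σ | σ i ∈ ({(k : NStar)} : Set NStar)} ∩ {σ | σ j ∈ ({(k : NStar)} : Set NStar)} := by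
    ext σ
    simp only [Set.mem_compl_iff, Set.mem_ofPred_eq, Classical.not_imp, Set.mem_iUnion,
      Set.mem_inter_iff, Set.mem_singleton_iff]
    constructor
    · rintro ⟨h1, h2⟩
      obtain ⟨k, hk⟩ := OnePoint.ne_infty_iff_exists.1 h2
      exact ⟨k, hk.symm, by rw [← h1, hk]⟩
    · rintro ⟨k, h1, h2⟩
      rw [h1, h2]
      exact ⟨rfl, OnePoint.coe_ne_infty k⟩
  rw [h]
  refine isOpen_iUnion fun k => ?_
  have hk : IsOpen ({(k : NStar)} : Set NStar) := by
    simpa using OnePoint.isOpenEmbedding_coe.isOpenMap {k} (isOpen_discrete _)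
  exact (hk.preimage (continuous_apply i)).inter (hk.preimage (continuous_apply j))

instance : CompactSpace SNStar :=
  isCompact_iff_compactSpace.1 isClosed_range_coe.isCompact

/-- Keep the first `N` letters, replace those larger than `N` by `∞`, and continue with `∞`. -/
def trunc (N : ℕ) (σ : SNStar) : SNStar :=
  ⟨fun j => if j.natPred < N then truncLetter N (σ j) else OnePoint.infty, by
    intro i j hij h
    by_contra hi
    -- A truncated value other than `∞` is the original one, so no new coincidences arise.
    have key : ∀ l : ℕ+, (if l.natPred < N then truncLetter N (σ l) else OnePoint.infty) ≠
        OnePoint.infty → (if l.natPred < N then truncLetter N (σ l) else OnePoint.infty) = σ l ∧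
          σ l ≠ OnePoint.infty := by
      intro l hl
      by_cases h1 : l.natPred < N
      swap
      · exact absurd (if_neg h1) hl
      rw [if_pos h1] at hl ⊢
      generalize σ l = x at *
      induction x using OnePoint.rec with
      | infty => exact absurd rfl hl
      | coe k =>
        rw [truncLetter_coe] at hl ⊢
        by_cases h2 : (k : ℕ) ≤ N
        · exact ⟨if_pos h2, OnePoint.coe_ne_infty k⟩
        · exact absurd (if_neg h2) hl
    have h1 := key i hi
    have h2 := key j (fun h' => hi (h.trans h'))
    exact h1.2 (σ.2 i j hij (h1.1.symm.trans (h.trans h2.1)))⟩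

theorem trunc_apply (N : ℕ) (σ : SNStar) (j : ℕ+) : (trunc N σ) j =
    if j.natPred < N then truncLetter N (σ j) else OnePoint.infty := rfl

theorem tendsto_trunc (σ : SNStar) :
    Tendsto (fun p : ℕ × SNStar => trunc p.1 p.2) (atTop ×ˢ 𝓝 σ) (𝓝 σ) := by
  rw [isEmbedding_coe.tendsto_nhds_iff, tendsto_pi_nhds]
  intro j
  have h1 : Tendsto (fun p : ℕ × SNStar => (p.1, p.2 j)) (atTop ×ˢ 𝓝 σ) (atTop ×ˢ 𝓝 (σ j)) := by
    refine tendsto_fst.prodMk (Tendsto.comp (g := fun τ : SNStar => τ j) ?_ tendsto_snd)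
    exact ((continuous_apply j).comp isEmbedding_coe.continuous).tendsto σ
  refine ((tendsto_truncLetter (σ j)).comp h1).congr' ?_
  filter_upwards [tendsto_fst.eventually (eventually_gt_atTop j.natPred)] with p hp
  simp only [Function.comp, trunc_apply, if_pos hp]

/-- `tendsto_trunc` is joint in `N` and `σ`, which gives locally uniform convergence; compactness
makes it uniform. -/
theorem tendstoUniformly_comp_trunc {f : SNStar → ℝ} (hf : Continuous f) :
    TendstoUniformly (fun N σ => f (trunc N σ)) f atTop := by
  rw [← tendstoLocallyUniformly_iff_tendstoUniformly_of_compactSpace,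
    tendstoLocallyUniformly_iff_forall_tendsto]
  intro σ
  have h1 : Tendsto (fun p : ℕ × SNStar => f p.2) (atTop ×ˢ 𝓝 σ) (𝓝 (f σ)) :=
    (hf.tendsto σ).comp tendsto_snd
  have h2 : Tendsto (fun p : ℕ × SNStar => f (trunc p.1 p.2)) (atTop ×ˢ 𝓝 σ) (𝓝 (f σ)) :=
    (hf.tendsto σ).comp (tendsto_trunc σ)
  exact (h1.prodMk_nhds h2).mono_right (nhds_le_uniformity _)

/-- The functional of words that computes `f (trunc N σ)` from the first `N` letters of `σ`. -/
noncomputable def wordFunctional (N : ℕ) (f : SNStar → ℝ) (w : List NStar) : ℝ :=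
  -- An arbitrary word need not define an element of `S(ℕ, ℕ*)`; the value is then 0.
  Function.extend (fun σ : SNStar => (σ : ℕ+ → NStar)) f 0
    fun j => ((w.map (truncLetter N)).take N).getD j.natPred OnePoint.infty

theorem isLocal_wordFunctional (N : ℕ) (f : SNStar → ℝ) : IsLocal N N (wordFunctional N f) := by
  intro w w' h
  simp only [wordFunctional, h]

theorem abs_wordFunctional_le {N : ℕ} {f : SNStar → ℝ} {B : ℝ} (h0 : 0 ≤ B) (h : ∀ σ, |f σ| ≤ B)
    (w : List NStar) : |wordFunctional N f w| ≤ B := by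
  classical
  rw [wordFunctional, Function.extend_def]
  split_ifs
  · exact h _
  · simpa using h0

theorem wordFunctional_eq {N : ℕ} {f : SNStar → ℝ} {w : List NStar} {σ : SNStar}
    (h : ∀ j : ℕ+, j.natPred < N → w.getD j.natPred OnePoint.infty = σ j) :
    wordFunctional N f w = f (trunc N σ) := by
  have h1 : (fun j : ℕ+ => ((w.map (truncLetter N)).take N).getD j.natPred OnePoint.infty) =
      (trunc N σ : ℕ+ → NStar) := by
    funext j
    rw [trunc_apply]
    split_ifs with hj
    · rw [← h j hj, List.getD_eq_getElem?_getD, List.getD_eq_getElem?_getD, List.getElem?_take,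
        if_pos hj, List.getElem?_map]
      cases w[j.natPred]? <;> rfl
    · rw [List.getD_eq_getElem?_getD, List.getElem?_take, if_neg hj]
      rfl
  rw [wordFunctional, h1]
  exact isEmbedding_coe.injective.extend_apply f 0 (trunc N σ)

theorem measurable_of_coordinates {Ω : Type*} [MeasurableSpace Ω] {F : Ω → SNStar}
    (hF : ∀ j, @Measurable _ _ _ (borel NStar) fun ω => (F ω) j) : Measurable F := by
  let _ : MeasurableSpace NStar := borel NStar
  have _ : BorelSpace NStar := ⟨rfl⟩
  have _ : SecondCountableTopology NStar := NStar.isEmbedding_tail.secondCountableTopology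
  have h : (inferInstance : MeasurableSpace SNStar) =
      MeasurableSpace.comap (fun σ : SNStar => (σ : ℕ+ → NStar)) inferInstance := by
    rw [(inferInstance : BorelSpace (ℕ+ → NStar)).measurable_eq, ← borel_comap,
      ← isEmbedding_coe.eq_induced]
    rfl
  have h2 : @Measurable _ _ _ (MeasurableSpace.comap (fun σ : SNStar => (σ : ℕ+ → NStar))
      inferInstance) F := measurable_comap_iff.2 (measurable_pi_iff.2 hF)
  rw [← h] at h2
  exact h2

end SNStar

theorem regenFun_apply (x : ℕ → ℕ) (π : ∀ I : FiniteBlock, AvoidingImage pattern231 I.1) {K : ℕ}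
    {j : ℕ+} (hj : (j : ℕ) ≤ K) : (regenFun x π) j =
      (blocksPrefix 0 (blockTree x π) K).getD j.natPred OnePoint.infty := by
  have h1 := le_length_concatPrefix (regenWord_ne_nil x π) (j : ℕ)
  have h2 := PNat.natPred_add_one j
  have h3 : (regenFun x π) j = (concatPrefix (regenWord x π) K)[j.natPred]'(by
      have := le_length_concatPrefix (regenWord_ne_nil x π) K
      omega) :=
    (concatPrefix_isPrefix (regenWord x π) hj).getElem (by omega)
  rw [h3, ← concatPrefix_regenWord, List.getD_eq_getElem]

theorem measurable_regenFun {Ω : Type*} [MeasurableSpace Ω]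
    {X : ℕ → Ω → ℕ} (hX_meas : ∀ j, Measurable (X j))
    {PI : ∀ I : FiniteBlock, Ω → AvoidingImage pattern231 I.1} (hPI_meas : ∀ I, Measurable (PI I)) :
    Measurable fun ω => regenFun (fun j => X j ω) (fun I => PI I ω) := by
  refine SNStar.measurable_of_coordinates fun j => ?_
  let _ : MeasurableSpace NStar := borel NStar
  simp only [regenFun_apply _ _ (le_refl (j : ℕ))]
  refine measurable_of_prefix (τ := fun ω => blockTree (fun j => X j ω) (fun I => PI I ω))
    (measurableSet_prefixEvent hX_meas hPI_meas) j
    (G := fun t => (blocksPrefix 0 t j).getD j.natPred OnePoint.infty) fun t t' h => ?_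
  rw [blocksPrefix_congr h]

/-! ### Weak convergence -/

theorem permToSNStar_apply {n N : ℕ} (σ : Equiv.Perm (Fin n)) (hN : N ≤ n) (j : ℕ+)
    (hj : j.natPred < N) :
    ((permWord σ).map fun k : ℕ+ => (k : NStar)).getD j.natPred OnePoint.infty =
      (permToSNStar σ) j := by
  have h1 : j.natPred < n := hj.trans_le hN
  rw [List.getD_eq_getElem _ _ (by simpa [permWord] using h1)]
  simp [permWord, permToSNStar, h1]

theorem integral_mu231 (n : ℕ) {f : SNStar → ℝ} (hf : Measurable f) :
    ∫ σ, f σ ∂(mu231 n : Measure SNStar) =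
      (∑ σ : AvoidingPerm pattern231 n, f (permToSNStar σ.1)) / catalan n := by
  let _ : MeasurableSpace (AvoidingPerm pattern231 n) := ⊤
  have _ : MeasurableSingletonClass (AvoidingPerm pattern231 n) := ⟨fun _ => trivial⟩
  have hm : Measurable fun σ : AvoidingPerm pattern231 n => permToSNStar σ.1 := fun _ _ => trivial
  have h1 : (mu231 n : Measure SNStar) = (PMF.uniformOfFintype (AvoidingPerm pattern231 n)).toMeasure.map
      (fun σ => permToSNStar σ.1) := (PMF.toMeasure_map _ _ hm).symm
  rw [h1, integral_map hm.aemeasurable hf.aestronglyMeasurable, PMF.integral_eq_sum,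
    Finset.sum_div]
  refine Finset.sum_congr rfl fun σ _ => ?_
  rw [PMF.uniformOfFintype_apply, card_avoidingPerm, ENNReal.toReal_inv, ENNReal.toReal_natCast,
    smul_eq_mul, inv_mul_eq_div]

theorem abs_integral_mu231_sub_le {n N : ℕ} (hN : N ≤ n) {f : SNStar → ℝ} (hf : Measurable f)
    {ε : ℝ} (h : ∀ σ, |f σ - f (SNStar.trunc N σ)| ≤ ε) :
    |∫ σ, f σ ∂(mu231 n : Measure SNStar) -
      treeAverage n fun t => SNStar.wordFunctional N f (treeLetters 0 t)| ≤ ε := by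
  have h1 := sum_avoidingPerm n fun w =>
    SNStar.wordFunctional N f (w.map fun k : ℕ+ => (k : NStar))
  have h2 : (catalan n : ℝ) ≠ 0 := by exact_mod_cast (catalan_pos n).ne'
  have h3 : (0 : ℝ) < catalan n := by exact_mod_cast catalan_pos n
  rw [integral_mu231 n hf, treeAverage]
  simp only [treeLetters]
  rw [← h1, ← sub_div, ← Finset.sum_sub_distrib, abs_div, Nat.abs_cast, div_le_iff₀ h3]
  refine (Finset.abs_sum_le_sum_abs _ _).trans ?_
  refine (Finset.sum_le_sum (g := fun _ => ε) fun σ _ => ?_).trans ?_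
  · rw [SNStar.wordFunctional_eq (permToSNStar_apply σ.1 hN)]
    exact h _
  · rw [Finset.sum_const, Finset.card_univ, card_avoidingPerm, nsmul_eq_mul, mul_comm]

/-! ### Surjectivity -/

theorem exists_regenFun_eq_of_mem {x : ℕ → ℕ} {π : ∀ I : FiniteBlock, AvoidingImage pattern231 I.1}
    {K : ℕ} {a : NStar} (ha : a ∈ concatPrefix (regenWord x π) K) :
    ∃ j, (regenFun x π) j = a := by
  obtain ⟨i, hi, rfl⟩ := List.getElem_of_mem ha
  refine ⟨i.succPNat, ?_⟩
  have h1 := (concatPrefix_isPrefix (regenWord x π) (le_max_left K i.succPNat)).getElem hi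
  rw [regenFun_apply x π (le_max_right K i.succPNat), ← concatPrefix_regenWord,
    Nat.natPred_succPNat, List.getD_eq_getElem, h1]

theorem surjective_regenFun {x : ℕ → ℕ} (π : ∀ I : FiniteBlock, AvoidingImage pattern231 I.1)
    (hx : ∀ m, ∃ k ≥ m, 0 < x k) : Function.Surjective (regenFun x π) := by
  have hunb : ∀ n, ∃ K, n ≤ partialSum x K := by
    intro n
    induction n with
    | zero => exact ⟨0, Nat.zero_le _⟩
    | succ n ih =>
      obtain ⟨K, hK⟩ := ih
      obtain ⟨k, hk, hpos⟩ := hx K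
      refine ⟨k + 1, ?_⟩
      have := monotone_partialSum x hk
      rw [partialSum_succ]
      omega
  intro a
  induction a using OnePoint.rec with
  | infty =>
    refine exists_regenFun_eq_of_mem (K := 1) ?_
    simp [concatPrefix, regenWord]
  | coe k =>
    classical
    -- The first `K` with `k ≤ T_K` is some `N + 1`, and `k` then lies in block `N`.
    have hK := Nat.find_spec (hunb k)
    have hmin := fun {m} => Nat.find_min (hunb k) (m := m)
    rcases hN : Nat.find (hunb k) with _ | N
    · rw [hN] at hK
      have h0 : partialSum x 0 = 0 := rfl
      have := k.pos
      omega
    · rw [hN] at hK hmin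
      have h1 := hmin (Nat.lt_succ_self N)
      refine exists_regenFun_eq_of_mem (K := N + 1) ?_
      rw [concatPrefix_succ, regenWord, List.mem_append, List.mem_append]
      refine Or.inr (Or.inl (List.mem_map.2 ⟨k, (avoidingImage_mem _).2 ?_, rfl⟩))
      exact mem_blockIcc.2 ⟨by omega, hK⟩

/-! ### The mean block length -/

theorem lintegral_catalanLaw : ∫⁻ n : ℕ, (n : ℝ≥0∞) ∂catalanLaw.toMeasure = ∞ := by
  rw [lintegral_countable']
  by_contra h
  have h1 := ENNReal.summable_toReal h
  have h2 : ∀ n : ℕ, ((n : ℝ≥0∞) * catalanLaw.toMeasure {n}).toReal =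
      n * ((catalan n : ℝ) / (2 * 4 ^ n)) := by
    intro n
    rw [PMF.toMeasure_apply_singleton _ _ (.singleton _), ENNReal.toReal_mul,
      ENNReal.toReal_natCast]
    exact congrArg _ (ENNReal.toReal_ofReal (by positivity))
  simp only [h2] at h1
  -- From `4^n < n * centralBinom n` for `n ≥ 4`, the term `n * P(X = n)` is at least `1 / (2 (n +
  -- 1))`; the shift by 4 leads to the harmonic series from 5 on.
  have h3 : Summable fun n : ℕ => (((n + 5 : ℕ) : ℝ))⁻¹ := by
    refine Summable.of_nonneg_of_le (fun n => by positivity) (fun n => ?_)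
      (((summable_nat_add_iff 4).2 h1).mul_left 2)
    have h4 := Nat.four_pow_lt_mul_centralBinom (n + 4) (by omega)
    rw [← succ_mul_catalan_eq_centralBinom] at h4
    have h5 : (4 : ℝ) ^ (n + 4) ≤ ((n + 4 : ℕ) : ℝ) * (((n + 5 : ℕ) : ℝ) * catalan (n + 4)) := by
      exact_mod_cast h4.le
    rw [inv_le_iff_one_le_mul₀ (by positivity)]
    have h6 : (0 : ℝ) < 4 ^ (n + 4) := by positivity
    have h7 : 2 * (((n + 4 : ℕ) : ℝ) * ((catalan (n + 4) : ℝ) / (2 * 4 ^ (n + 4)))) *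
        ((n + 5 : ℕ) : ℝ) =
        ((n + 4 : ℕ) : ℝ) * (((n + 5 : ℕ) : ℝ) * catalan (n + 4)) / 4 ^ (n + 4) := by
      field_simp
    rw [h7, le_div_iff₀ h6, one_mul]
    exact h5
  exact Real.not_summable_natCast_inv ((summable_nat_add_iff 5).1 h3)

theorem lintegral_length {Ω : Type*} [MeasurableSpace Ω] {P : Measure Ω} {Y : Ω → ℕ} (hY : Measurable Y) (hlaw : P.map Y = catalanLaw.toMeasure) :
    ∫⁻ ω, (Y ω : ℝ≥0∞) ∂P = ∞ := by
  rw [← lintegral_catalanLaw, ← hlaw, lintegral_map (measurable_of_countable _) hY]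

section Probability

variable {Ω : Type*} [MeasurableSpace Ω] {P : Measure Ω}

theorem ae_exists_length_pos {X : ℕ → Ω → ℕ} (hX_meas : ∀ j, Measurable (X j))
    (hX_indep : iIndepFun X P) (hX_law : ∀ j, P.map (X j) = catalanLaw.toMeasure) :
    ∀ᵐ ω ∂P, ∀ m, ∃ k ≥ m, 0 < X k ω := by
  rw [ae_all_iff]
  intro m
  rw [ae_iff]
  have hprob : ∀ k, P (X k ⁻¹' {0}) = ENNReal.ofReal (1 / 2) := by
    intro k
    rw [← Measure.map_apply (hX_meas k) (.singleton _), hX_law,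
      PMF.toMeasure_apply_singleton _ _ (.singleton _)]
    change ENNReal.ofReal ((catalan 0 : ℝ) / (2 * 4 ^ 0)) = _
    simp
  -- The event forces `n` independent lengths to vanish, each with probability 1/2.
  have hle : ∀ n : ℕ, P {ω | ¬ ∃ k ≥ m, 0 < X k ω} ≤ ENNReal.ofReal (1 / 2) ^ n := by
    intro n
    have h1 := hX_indep.measure_inter_preimage_eq_mul (Finset.Ico m (m + n))
      (sets := fun _ => {0}) fun _ _ => .singleton _
    simp only [hprob, Finset.prod_const, Nat.card_Ico, Nat.add_sub_cancel_left] at h1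
    rw [← h1]
    refine measure_mono fun ω hω => ?_
    simp only [Set.mem_iInter, Set.mem_preimage, Set.mem_singleton_iff, Finset.mem_Ico]
    intro k hk
    by_contra h
    exact hω ⟨k, hk.1, Nat.pos_of_ne_zero h⟩
  have hlim : Tendsto (fun n : ℕ => ENNReal.ofReal (1 / 2) ^ n) atTop (𝓝 0) :=
    ENNReal.tendsto_pow_atTop_nhds_zero_of_lt_one (by simp)
  exact le_antisymm (ge_of_tendsto' hlim hle) zero_le

/-! ### Weak convergence to the law of the random word -/

theorem tendsto_integral_mu231 [IsProbabilityMeasure P] {X : ℕ → Ω → ℕ} (hX_meas : ∀ j, Measurable (X j))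
    (hX_indep : iIndepFun X P) (hX_law : ∀ j, P.map (X j) = catalanLaw.toMeasure)
    {PI : ∀ I : FiniteBlock, Ω → AvoidingImage pattern231 I.1} (hPI_meas : ∀ I, Measurable (PI I))
    (hPI_indep : iIndepFun PI P)
    (hPI_law : ∀ I, P.map (PI I) =
      (PMF.uniformOfFintype (AvoidingImage pattern231 I.1)).toMeasure)
    (hX_PI : IndepFun (fun ω j => X j ω) (fun ω I => PI I ω) P)
    {f : SNStar → ℝ} (hf : Continuous f) {B : ℝ} (hB : ∀ σ, |f σ| ≤ B) :
    Tendsto (fun n => ∫ σ, f σ ∂(mu231 n : Measure SNStar)) atTop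
      (𝓝 (∫ ω, f (regenFun (fun j => X j ω) (fun I => PI I ω)) ∂P)) := by
  let τ : Ω → ℕ → BinaryTree Unit := fun ω => blockTree (fun j => X j ω) (fun I => PI I ω)
  have hτ : ∀ m t, MeasurableSet (prefixEvent τ m t) := measurableSet_prefixEvent hX_meas hPI_meas
  have hB0 : 0 ≤ B := (abs_nonneg _).trans (hB (permToSNStar (1 : Equiv.Perm (Fin 0))))
  rw [Metric.tendsto_atTop]
  intro ε hε
  -- Three errors of size `ε / 4`: truncation under `μ_n`, truncation under the law of `Z`, and the
  -- convergence of tree averages.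
  obtain ⟨N, hN⟩ := ((Metric.tendstoUniformly_iff.1 (SNStar.tendstoUniformly_comp_trunc hf))
    (ε / 4) (by positivity)).exists
  have hN' : ∀ σ, |f σ - f (SNStar.trunc N σ)| ≤ ε / 4 := fun σ => (hN σ).le
  have hbd := SNStar.abs_wordFunctional_le (N := N) hB0 hB
  have hexp : ∫ ω, SNStar.wordFunctional N f (blocksPrefix 0 (τ ω) N) ∂P =
      limitExp N 0 (SNStar.wordFunctional N f) := by
    have h1 := integral_blocksPrefix hτ (measure_prefixEvent hX_meas hX_indep hX_law hPI_meas
      hPI_indep hPI_law hX_PI) N 0 hbd 0 (fun _ => .nil)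
    have h2 : prefixEvent τ 0 (fun _ => .nil) = Set.univ := by
      ext ω; simp [prefixEvent]
    simpa [h2] using h1
  have hclose : |∫ ω, f (regenFun (fun j => X j ω) (fun I => PI I ω)) ∂P -
      limitExp N 0 (SNStar.wordFunctional N f)| ≤ ε / 4 := by
    have hm1 : Integrable (fun ω => f (regenFun (fun j => X j ω) (fun I => PI I ω))) P :=
      Integrable.of_bound
        (hf.measurable.comp (measurable_regenFun hX_meas hPI_meas)).aestronglyMeasurable
        B (ae_of_all _ fun ω => hB _)
    have hm2 : Integrable (fun ω => SNStar.wordFunctional N f (blocksPrefix 0 (τ ω) N)) P := by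
      refine Integrable.of_bound (Measurable.aestronglyMeasurable ?_) B
        (ae_of_all _ fun ω => hbd _)
      refine measurable_of_prefix hτ N
        (G := fun t => SNStar.wordFunctional N f (blocksPrefix 0 t N)) fun t t' h => ?_
      rw [blocksPrefix_congr h]
    rw [← hexp, ← integral_sub hm1 hm2]
    have h3 := norm_integral_le_of_norm_le_const (μ := P) (C := ε / 4)
      (f := fun ω => f (regenFun (fun j => X j ω) (fun I => PI I ω)) -
        SNStar.wordFunctional N f (blocksPrefix 0 (τ ω) N)) (ae_of_all _ fun ω => by
        rw [SNStar.wordFunctional_eq (σ := regenFun (fun j => X j ω) (fun I => PI I ω))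
          fun j hj => (regenFun_apply _ _ (by
            have := PNat.natPred_add_one j
            omega)).symm]
        exact hN' _)
    simpa using h3
  have hlim := tendsto_treeAverage (SNStar.isLocal_wordFunctional N f) hbd 0
  obtain ⟨n0, hn0⟩ := Metric.tendsto_atTop.1 hlim (ε / 4) (by positivity)
  refine ⟨max n0 N, fun n hn => ?_⟩
  have h1 := abs_integral_mu231_sub_le (le_trans (le_max_right _ _) hn) hf.measurable hN'
  have h2 := hn0 n (le_trans (le_max_left _ _) hn)
  rw [Real.dist_eq] at h2 ⊢
  rw [abs_le] at h1 hclose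
  rw [abs_lt] at h2 ⊢
  constructor <;> linarith [h1.1, h1.2, h2.1, h2.2, hclose.1, hclose.2]

end Probability

theorem theorem231 {Ω : Type*} [MeasurableSpace Ω] (P : Measure Ω) [IsProbabilityMeasure P]
    -- the lengths `X_1, X_2, …` (`X j` is `X_{j+1}`): independent, with the law of `X`
    (X : ℕ → Ω → ℕ) (hX_meas : ∀ j, Measurable (X j))
    (hX_indep : iIndepFun X P)
    (hX_law : ∀ j, P.map (X j) = catalanLaw.toMeasure)
    -- the images `Π_I` of the finite blocks `I`: independent, uniform over the avoiding images
    (PI : ∀ I : FiniteBlock, Ω → AvoidingImage pattern231 I.1) (hPI_meas : ∀ I, Measurable (PI I))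
    (hPI_indep : iIndepFun PI P)
    (hPI_law : ∀ I, P.map (PI I) =
      (PMF.uniformOfFintype (AvoidingImage pattern231 I.1)).toMeasure)
    -- the two families are independent of each other
    (hX_PI : IndepFun (fun ω j => X j ω) (fun ω I => PI I ω) P) :
    -- the concatenation is an almost surely surjective random element of `S(ℕ, ℕ*)`, and its law
    -- is the weak limit of `μ_n^{231}`; the block lengths have infinite mean
    (∃ ν : ProbabilityMeasure SNStar,
      HasLaw (fun ω => regenFun (fun j => X j ω) (fun I => PI I ω)) (ν : Measure SNStar) P ∧
      Tendsto mu231 atTop (𝓝 ν)) ∧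
    (∀ᵐ ω ∂P, Function.Surjective (regenFun (fun j => X j ω) (fun I => PI I ω))) ∧
    (∀ j, ∫⁻ ω, (X j ω : ℝ≥0∞) ∂P = ∞) := by
  have hZ := measurable_regenFun hX_meas hPI_meas
  let ν : ProbabilityMeasure SNStar :=
    ⟨P.map fun ω => regenFun (fun j => X j ω) (fun I => PI I ω),
      Measure.isProbabilityMeasure_map hZ.aemeasurable⟩
  have hν : (ν : Measure SNStar) = P.map fun ω => regenFun (fun j => X j ω) (fun I => PI I ω) := rfl
  refine ⟨⟨ν, ⟨hZ.aemeasurable, hν.symm⟩, ?_⟩, ?_, ?_⟩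
  · rw [ProbabilityMeasure.tendsto_iff_forall_integral_tendsto]
    intro f
    rw [hν, integral_map hZ.aemeasurable f.continuous.measurable.aestronglyMeasurable]
    exact tendsto_integral_mu231 hX_meas hX_indep hX_law hPI_meas hPI_indep hPI_law hX_PI
      f.continuous (B := ‖f‖) f.norm_coe_le_norm
  · filter_upwards [ae_exists_length_pos hX_meas hX_indep hX_law] with ω hω
    exact surjective_regenFun _ hω
  · exact fun j => lintegral_length (hX_meas j) (hX_law j)
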